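/- **Setting.** Let $n\ge 1$, let $X=(x_1,\dots,x_p)\in\mathbb R^{n\times p}$ have columns with $\|x_j\|_2^2=n$, and let $y=X\beta+\varepsilon$, $S=\mathrm{supp}(\beta)$, where $X_S^\top X_S$ is invertible. Let $P_S$ be the orthogonal projection onto the column space of $X_S$, $P_S^\perp=I-P_S$, and let $\hat\beta^o$ be the oracle LSE: $\hat\beta^o_S=(X_S^\top X_S)^{-1}X_S^\top y$, $\hat\beta^o_{S^c}=0$. For fixed $\lambda>0$ let $\rho(t)=\rho(t;\lambda)$ satisfy: $\rho(0)=0$, $\rho(-t)=\rho(t)$, $\rho$ is nondecreasing on $[0,\infty)$, $\rho(x+y)\le\rho(x)+\rho(y)$ for $x,y\ge0$, and $\rho$ is left- and right-differentiable at every $t>0$. Put $\|\rho(b)\|_1=\sum_j\rho(b_j)$, $\lambda^*=\inf_{t>0}\{t/2+\rho(t)/t\}$, and let $\dot\rho(t)$ denote any value between the left and right derivatives of $\rho$ at $t$ (the one-sided derivatives at $0$ may be infinite; $\dot\rho(0+)$ is the right derivative at $0$). The global solution is the unique minimizer over $b\in\mathbb R^p$ of $L(b)=\|y-Xb\|_2^2/(2n)+\|\rho(b)\|_1$.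 A vector $b$ is an approximate local solution with excess $\nu\ge0$ if $\|X^\top(Xb-y)/n+\dot\rho(b)\|_2^2\le\nu$ for some choice of the values $\dot\rho(b_j)$, and a local solution if $\nu=0$. For $\kappa\ge0$ let $\theta(t,\kappa)=\sup_s\{-\mathrm{sgn}(s-t)(\dot\rho(s)-\dot\rho(t))-\kappa|s-t|\}$, where the supremum is also over the admissible values of $\dot\rho(s)$. When $b$ is a local solution, $\theta(b,\kappa)=0$ means that $\theta(b_j,\kappa)=0$ for all $j$, with $\dot\rho(b_j)$ the value for which the local-solution equation holds. For $\eta\in(0,1)$, $\eta$ null-consistency means $\min_b\{\|\varepsilon/\eta-Xb\|_2^2/(2n)+\|\rho(b)\|_1\}=\|\varepsilon/\eta\|_2^2/(2n)$. Let $\kappa_-(m)$ and $\kappa_+(m)$ be the minimum and maximum of $\|Xu\|_2^2/n$ over $\|u\|_0\le m$, $\|u\|_2=1$ (minimum over the empty set $=\infty$). Let $\xi=(1+\eta)/(1-\eta)$, $$\mathrm{RIF}_1=\inf\Big\{\tfrac{|S|\,\|X^\top Xu\|_\infty}{n\|u\|_1}:\|\rho(u_{S^c})\|_1<\xi\|\rho(u_S)\|_1\Big\},\qquad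 \Delta(a,k)=\sup\{\|\rho(b)\|_1:\|b\|_1\le ak,\ \|b\|_0=k\},$$ and $\Delta=\Delta\big((1+\eta)\lambda^*/\mathrm{RIF}_1,|S|\big)$ (with $1/0=\infty$, $1/\infty=0$). Call $m$ *admissible* for $\eta$ if one of the following holds. (A) $\Delta<\infty$ and $m=m_0+\lfloor\xi\Delta/\rho(t_0)\rfloor$, where either $t_0>0$ is real, $m_0\ge1$ is an integer and $\sqrt{2\xi\kappa_+(m_0)\Delta/m_0}+\|X^\top\varepsilon/n\|_\infty<\inf_{0<s<t_0}\dot\rho(s)$, or $t_0=m_0=0$ and $\rho(t_0)$ is read as $\rho(0+)>0$. (B) $\lambda^*=\lambda$, $\rho$ is bounded and concave on $(0,\infty)$, $\gamma^*=\sup_t\rho(t)/\lambda^2$, and for some $a_0>0$, $a_1\ge0$, $\gamma>0$, $\alpha>0$: $1-a_1/\gamma>\eta$, $\dot\rho(a_0\lambda)\ge\lambda(1-a_1/\gamma)$, $\alpha|S|$ is an integer, $2\gamma^*\kappa_+(\alpha|S|)/\alpha<(1-a_1/\gamma-\eta)^2(1-\eta)/(1+\eta)$, and, with $g=(\gamma^*/a_0)/(1-a_1/\gamma)$,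 either $m=(\alpha+g)|S|$ and $(\xi-1)g\le\alpha$, or $m=(\alpha+\xi g)|S|$. **Theorem.** (i) Suppose $\|X_{S^c}^\top P_S^\perp\varepsilon/n\|_\infty\le\dot\rho(0+)$. Then $\hat\beta^o$ is an approximate local solution with excess $\nu=\|\dot\rho(\hat\beta^o_S)\|_2^2$. If in addition $\eta$ null-consistency holds and $\nu=0=\theta(\hat\beta^o,\kappa)$ for some $0\le\kappa<\kappa_-(m+|S|)$ with $m$ admissible for $\eta$, then $\hat\beta^o$ is the global solution. (ii) Fix a version of $\dot\rho$ (one admissible value at each $t$) and let $$\theta_1=\inf\big\{\theta\ge0:\ \|(X_S^\top X_S/n)^{-1}\dot\rho(v_S+\hat\beta^o_S)\|_\infty\le\theta\lambda^*\ \ \forall\,\|v_S\|_\infty\le\theta\lambda^*\big\},$$ $$\theta_2=\sup\big\{\|X_{S^c}^\top X_S(X_S^\top X_S)^{-1}\dot\rho(v_S+\hat\beta^o_S)\|_\infty/\lambda^*:\ \|v_S\|_\infty\le\theta_1\lambda^*\big\}.$$ Suppose $\theta_1<\infty$, $\dot\rho$ is uniformly continuous on $\bigcup_{j\in S}[\hat\beta^o_j-\theta_1\lambda^*,\hat\beta^o_j+\theta_1\lambda^*]$,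 $\mathrm{sgn}(\hat\beta^o)=\mathrm{sgn}(\beta)$, $\min_{j\in S}|\hat\beta^o_j|>\theta_1\lambda^*$, $\theta_2<1$ and $\lambda^*\ge\|X^\top P_S^\perp\varepsilon/n\|_\infty/(1-\theta_2)$. Then there is a local solution $\tilde\beta^o$ with $\mathrm{sgn}(\tilde\beta^o)=\mathrm{sgn}(\beta)$ and $\|\tilde\beta^o-\hat\beta^o\|_\infty\le\theta_1\lambda^*$. If in addition $\eta$ null-consistency holds, then any such $\tilde\beta^o$ with $\theta(\tilde\beta^o,\kappa)=0$ for some $0\le\kappa<\kappa_-(m+|S|)$, with $m$ admissible for $\eta$, is the global solution. -/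

import Mathlib

namespace PenLS

open Filter Topology Matrix

noncomputable section

/-- Standing conditions on the penalty `ρ = ρ(·; λ)`. -/
structure IsPenalty (ρ : ℝ → ℝ) : Prop where
  zero : ρ 0 = 0
  even : ∀ t, ρ (-t) = ρ t
  mono : MonotoneOn ρ (Set.Ici 0)
  subadd : ∀ x y, 0 ≤ x → 0 ≤ y → ρ (x + y) ≤ ρ x + ρ y

/-- Left- and right-differentiability at every `t > 0`. -/
def LRDifferentiable (ρ : ℝ → ℝ) : Prop :=
  ∀ t : ℝ, 0 < t →
    DifferentiableWithinAt ℝ ρ (Set.Iio t) t ∧ DifferentiableWithinAt ℝ ρ (Set.Ioi t) t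

/-- `a ∈ [-∞, ∞]` is the right derivative of `ρ` at `t`; at `t = 0` this is `ρ̇(0+)`, which is
infinite for instance for the bridge penalties. -/
def HasRightSlope (ρ : ℝ → ℝ) (t : ℝ) (a : EReal) : Prop :=
  Tendsto (fun h : ℝ => (((ρ (t + h) - ρ t) / h : ℝ) : EReal)) (𝓝[>] 0) (𝓝 a)

/-- `a ∈ [-∞, ∞]` is the left derivative of `ρ` at `t`. -/
def HasLeftSlope (ρ : ℝ → ℝ) (t : ℝ) (a : EReal) : Prop :=
  Tendsto (fun h : ℝ => (((ρ (t + h) - ρ t) / h : ℝ) : EReal)) (𝓝[<] 0) (𝓝 a)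

/-- The set of admissible values of `ρ̇(t)`: all reals between the left and the right derivative. -/
def pdot (ρ : ℝ → ℝ) (t : ℝ) : Set ℝ :=
  {d | ∃ a b : EReal, HasLeftSlope ρ t a ∧ HasRightSlope ρ t b ∧
    min a b ≤ (d : EReal) ∧ (d : EReal) ≤ max a b}

/-- The threshold level `λ* = inf_{t > 0} (t / 2 + ρ(t) / t)`. -/
def threshold (ρ : ℝ → ℝ) : ℝ :=
  sInf ((fun t : ℝ => t / 2 + ρ t / t) '' Set.Ioi 0)

/-- The support of a vector. -/
def supp {p : ℕ} (b : Fin p → ℝ) : Finset (Fin p) :=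
  Finset.univ.filter (fun j => b j ≠ 0)

/-- The penalized least squares loss. -/
def loss {n p : ℕ} (X : Matrix (Fin n) (Fin p) ℝ) (y : Fin n → ℝ) (ρ : ℝ → ℝ)
    (b : Fin p → ℝ) : ℝ :=
  (∑ i, (y i - (X *ᵥ b) i) ^ 2) / (2 * n) + ∑ j, ρ (b j)

/-- `b` is the (unique) global minimizer of the penalized loss. -/
def IsGlobalSolution {n p : ℕ} (X : Matrix (Fin n) (Fin p) ℝ) (y : Fin n → ℝ) (ρ : ℝ → ℝ)
    (b : Fin p → ℝ) : Prop :=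
  IsMinOn (loss X y ρ) Set.univ b ∧ ∀ b', IsMinOn (loss X y ρ) Set.univ b' → b' = b

/-- `b` is an approximate local solution with excess `ν`, where `d j` is the value chosen for
`ρ̇(b j)`. -/
def IsApproxLocalWith {n p : ℕ} (X : Matrix (Fin n) (Fin p) ℝ) (y : Fin n → ℝ) (ρ : ℝ → ℝ)
    (ν : ℝ) (b d : Fin p → ℝ) : Prop :=
  (∀ j, d j ∈ pdot ρ (b j)) ∧ ∑ j, ((Xᵀ *ᵥ (X *ᵥ b - y)) j / n + d j) ^ 2 ≤ ν

/-- `b` is an approximate local solution with excess `ν`. -/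
def IsApproxLocal {n p : ℕ} (X : Matrix (Fin n) (Fin p) ℝ) (y : Fin n → ℝ) (ρ : ℝ → ℝ)
    (ν : ℝ) (b : Fin p → ℝ) : Prop :=
  ∃ d, IsApproxLocalWith X y ρ ν b d

/-- The nonconvexity measure `θ(t, κ)`, where `d` is the value of `ρ̇(t)`; the supremum runs over
all `s` and all admissible values `e` of `ρ̇(s)`. -/
def nonconvexity (ρ : ℝ → ℝ) (κ t d : ℝ) : EReal :=
  ⨆ s : ℝ, ⨆ e ∈ pdot ρ s, ((-Real.sign (s - t) * (e - d) - κ * |s - t| : ℝ) : EReal)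

/-- The `η` null-consistency condition. -/
def NullConsistent {n p : ℕ} (X : Matrix (Fin n) (Fin p) ℝ) (ε : Fin n → ℝ) (ρ : ℝ → ℝ)
    (η : ℝ) : Prop :=
  IsLeast
    (Set.range fun b : Fin p → ℝ =>
      (∑ i, (ε i / η - (X *ᵥ b) i) ^ 2) / (2 * n) + ∑ j, ρ (b j))
    ((∑ i, (ε i / η) ^ 2) / (2 * n))

/-- The lower sparse eigenvalue `κ₋(m)` (`∞` when there is no unit vector with at most `m`
nonzero entries). -/
def kappaMinus {n p : ℕ} (X : Matrix (Fin n) (Fin p) ℝ) (m : ℝ) : ENNReal :=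
  ⨅ u ∈ {u : Fin p → ℝ | ((supp u).card : ℝ) ≤ m ∧ ∑ j, u j ^ 2 = 1},
    ENNReal.ofReal ((∑ i, (X *ᵥ u) i ^ 2) / n)

/-- The upper sparse eigenvalue `κ₊(m)`. -/
def kappaPlus {n p : ℕ} (X : Matrix (Fin n) (Fin p) ℝ) (m : ℝ) : ℝ :=
  sSup ((fun u : Fin p → ℝ => (∑ i, (X *ᵥ u) i ^ 2) / n) ''
    {u | ((supp u).card : ℝ) ≤ m ∧ ∑ j, u j ^ 2 = 1})

/-- The restricted invertibility factor `RIF₁(ξ, S)`, with values in `[0, ∞]`. -/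
def RIF1 {n p : ℕ} (X : Matrix (Fin n) (Fin p) ℝ) (ρ : ℝ → ℝ) (ξ : ℝ)
    (S : Finset (Fin p)) : ENNReal :=
  ⨅ u ∈ {u : Fin p → ℝ | ∑ j ∈ Sᶜ, ρ (u j) < ξ * ∑ j ∈ S, ρ (u j)},
    ENNReal.ofReal ((S.card : ℝ) * ‖Xᵀ *ᵥ (X *ᵥ u)‖ / (n * ∑ j, |u j|))

/-- `Δ(a, k) = sup {‖ρ(b)‖₁ : ‖b‖₁ ≤ a k, ‖b‖₀ = k}` over `b ∈ ℝᵖ`, with values in `[0, ∞]`. -/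
def Delta (p : ℕ) (ρ : ℝ → ℝ) (a : ENNReal) (k : ℕ) : ENNReal :=
  ⨆ b ∈ {b : Fin p → ℝ | ENNReal.ofReal (∑ j, |b j|) ≤ a * k ∧ (supp b).card = k},
    ENNReal.ofReal (∑ j, ρ (b j))

/-- `ρ(t₀)`, read as the right limit `ρ(0+)` when `t₀ = 0`. -/
def valueAt (ρ : ℝ → ℝ) (t0 : ℝ) : ℝ :=
  if t0 = 0 then sInf (ρ '' Set.Ioi 0) else ρ t0

/-- `ξ = (1 + η) / (1 - η)`. -/
def xi (η : ℝ) : ℝ := (1 + η) / (1 - η)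

/-- `Δ(a₁ λ*, |S|)` with `a₁ = (1 + η) / RIF₁(ξ, S)`. -/
def DeltaS {n p : ℕ} (X : Matrix (Fin n) (Fin p) ℝ) (ρ : ℝ → ℝ) (S : Finset (Fin p))
    (η : ℝ) : ENNReal :=
  Delta p ρ (ENNReal.ofReal (1 + η) / RIF1 X ρ (xi η) S * ENNReal.ofReal (threshold ρ)) S.card

/-- The sparsity bound `m = m₀ + ⌊ξ Δ(a₁ λ*, |S|) / ρ(t₀)⌋`, for `t₀, m₀` with `t₀ = m₀ = 0` or
`t₀, m₀ > 0` and
`(2 ξ κ₊(m₀) Δ(a₁ λ*, |S|) / m₀)^{1/2} + ‖Xᵀ ε / n‖_∞ < inf_{0 < s < t₀} ρ̇(s)`. -/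
def IsSparsityBound {n p : ℕ} (X : Matrix (Fin n) (Fin p) ℝ) (ε : Fin n → ℝ) (ρ : ℝ → ℝ)
    (S : Finset (Fin p)) (η m : ℝ) : Prop :=
  ∃ (t0 : ℝ) (m0 : ℕ), DeltaS X ρ S η ≠ ⊤ ∧ 0 < valueAt ρ t0 ∧
    ((t0 = 0 ∧ m0 = 0) ∨
      (0 < t0 ∧ 0 < m0 ∧
        ((Real.sqrt (2 * xi η * kappaPlus X m0 * (DeltaS X ρ S η).toReal / m0)
            + ‖fun j : Fin p => (Xᵀ *ᵥ ε) j / n‖ : ℝ) : EReal)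
          < ⨅ s ∈ Set.Ioo 0 t0, ⨅ d ∈ pdot ρ s, (d : EReal))) ∧
    m = m0 + (⌊xi η * (DeltaS X ρ S η).toReal / valueAt ρ t0⌋₊ : ℝ)

/-- The sparsity bound for bounded concave penalties with threshold level `λ* = λ`, where
`γ* = sup ρ / λ²` and `g = (γ* / a₀) / (1 - a₁ / γ)`: `m = (α + g) |S|` provided that
`(ξ - 1) g ≤ α`, and `m = (α + ξ g) |S|` in any case. -/
def IsSparsityBoundBounded {n p : ℕ} (X : Matrix (Fin n) (Fin p) ℝ) (ρ : ℝ → ℝ) (lam : ℝ)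
    (S : Finset (Fin p)) (η m : ℝ) : Prop :=
  ∃ (γs a0 a1 γ α g : ℝ) (m0 : ℕ),
    threshold ρ = lam ∧ ConcaveOn ℝ (Set.Ioi 0) ρ ∧
    BddAbove (Set.range ρ) ∧ γs = sSup (Set.range ρ) / lam ^ 2 ∧
    0 < a0 ∧ 0 ≤ a1 ∧ 0 < γ ∧ η < 1 - a1 / γ ∧
    (∃ d ∈ pdot ρ (a0 * lam), lam * (1 - a1 / γ) ≤ d) ∧
    0 < α ∧ (m0 : ℝ) = α * S.card ∧
    2 * γs * kappaPlus X m0 / α < (1 - a1 / γ - η) ^ 2 * (1 - η) / (1 + η) ∧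
    g = (γs / a0) / (1 - a1 / γ) ∧
    (((xi η - 1) * g ≤ α ∧ m = (α + g) * S.card) ∨ m = (α + xi η * g) * S.card)

/-- The columns `X_S`. -/
def cols {n p : ℕ} (X : Matrix (Fin n) (Fin p) ℝ) (S : Finset (Fin p)) :
    Matrix (Fin n) {j // j ∈ S} ℝ :=
  X.submatrix id Subtype.val

/-- The Gram matrix `X_Sᵀ X_S`. -/
def gram {n p : ℕ} (X : Matrix (Fin n) (Fin p) ℝ) (S : Finset (Fin p)) :
    Matrix {j // j ∈ S} {j // j ∈ S} ℝ :=
  (cols X S)ᵀ * cols X S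

/-- The oracle least squares estimator: `(X_Sᵀ X_S)⁻¹ X_Sᵀ y` on `S` and zero off `S`. -/
def oracle {n p : ℕ} (X : Matrix (Fin n) (Fin p) ℝ) (y : Fin n → ℝ) (S : Finset (Fin p)) :
    Fin p → ℝ :=
  fun j => if h : j ∈ S then ((gram X S)⁻¹ *ᵥ ((cols X S)ᵀ *ᵥ y)) ⟨j, h⟩ else 0

/-- The column space of `X_S`. -/
def colSpace {n p : ℕ} (X : Matrix (Fin n) (Fin p) ℝ) (S : Finset (Fin p)) :
    Submodule ℝ (EuclideanSpace ℝ (Fin n)) :=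
  Submodule.span ℝ ((fun j => WithLp.toLp 2 (fun i => X i j)) '' (S : Set (Fin p)))

/-- `P_S^⊥ ε`, with `P_S` the orthogonal projection onto the column space of `X_S`. -/
def projPerp {n p : ℕ} (X : Matrix (Fin n) (Fin p) ℝ) (S : Finset (Fin p)) (ε : Fin n → ℝ) :
    Fin n → ℝ :=
  fun i => ((colSpace X S)ᗮ.starProjection (WithLp.toLp 2 ε)) i

/-- The set of `θ ≥ 0` such that `‖(X_Sᵀ X_S / n)⁻¹ ρ̇(v_S + b_S)‖_∞ ≤ θ λ*` for all
`‖v_S‖_∞ ≤ θ λ*`; here `r` is the chosen version of `ρ̇`. -/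
def theta1Set {n p : ℕ} (X : Matrix (Fin n) (Fin p) ℝ) (S : Finset (Fin p)) (lamStar : ℝ)
    (r : ℝ → ℝ) (b : Fin p → ℝ) : Set ℝ :=
  {θ | 0 ≤ θ ∧ ∀ v : {j // j ∈ S} → ℝ, ‖v‖ ≤ θ * lamStar →
    ‖((n : ℝ)⁻¹ • gram X S)⁻¹ *ᵥ (fun j => r (v j + b j))‖ ≤ θ * lamStar}

/-- `θ₁`. -/
def theta1 {n p : ℕ} (X : Matrix (Fin n) (Fin p) ℝ) (S : Finset (Fin p)) (lamStar : ℝ)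
    (r : ℝ → ℝ) (b : Fin p → ℝ) : ℝ :=
  sInf (theta1Set X S lamStar r b)

/-- `θ₂ = sup {‖X_{Sᶜ}ᵀ X_S (X_Sᵀ X_S)⁻¹ ρ̇(v_S + b_S)‖_∞ / λ* : ‖v_S‖_∞ ≤ θ₁ λ*}`. -/
def theta2 {n p : ℕ} (X : Matrix (Fin n) (Fin p) ℝ) (S : Finset (Fin p)) (lamStar : ℝ)
    (r : ℝ → ℝ) (b : Fin p → ℝ) : ℝ :=
  sSup ((fun v : {j // j ∈ S} → ℝ =>
      ‖(cols X Sᶜ)ᵀ *ᵥ (cols X S *ᵥ ((gram X S)⁻¹ *ᵥ (fun j => r (v j + b j))))‖ / lamStar) ''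
    {v | ‖v‖ ≤ theta1 X S lamStar r b * lamStar})

end

end PenLS

/-!
Let `b'` be a global minimizer and `u = b' - β`. Its first-order conditions say that the scores
`-(Xᵀ(X b' - y)/n)ⱼ` are slopes of `ρ` at `b'ⱼ` of size at most `λ*`. Comparing the losses at
`b'` and `β`, with null-consistency absorbing the noise, gives the cone inequality
`‖X u‖²/(2n) + ‖ρ(u_{Sᶜ})‖₁ ≤ ξ ‖ρ(u_S)‖₁`, whose right side is at most `ξ Δ`. This budget limits
the number of nonzero `uⱼ` off `S`: the large ones each cost a definite amount of `ρ`, and at the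
small ones the slope of `ρ` exceeds the noise, so that `Xᵀ X u / n` is large there, which costs
energy through `κ₊`. Hence `b'` has at most `m` nonzero coordinates off `S`. If `b` is a local
solution supported in `S`, then `b' - b` has at most `m + |S|` nonzero coordinates; subtracting
the first-order conditions gives `‖X(b' - b)‖²/n ≤ κ ‖b' - b‖²`, and `κ < κ₋(m + |S|)` forces
`b' = b`. As a minimizer exists, `b` is the global solution.

The residual of the oracle estimator is `P_S^⊥ ε`, which gives its first-order conditions. A
local solution near it is `β̂ᵒ + w`, where `w_S` solves `(X_Sᵀ X_S/n) w_S + ρ̇(w_S + β̂ᵒ_S) = 0`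
in the box `‖w_S‖_∞ ≤ θ₁ λ*`. This is the stationarity equation of a potential, since `ρ̇` acts
coordinatewise; that `θ₁` makes the box invariant under `w ↦ -(X_Sᵀ X_S/n)⁻¹ ρ̇(w + β̂ᵒ_S)` shows
that the minimizer of the potential over the box is stationary, so no fixed-point theorem is
needed.
-/

namespace PenLS

open Filter Topology Matrix

noncomputable section

variable {n p : ℕ} {ρ : ℝ → ℝ}

/-! ### The penalty -/

namespace IsPenalty

theorem map_abs (hρ : IsPenalty ρ) (t : ℝ) : ρ |t| = ρ t := by
  rcases abs_choice t with h | h <;> rw [h]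
  exact hρ.even t

theorem le_of_abs_le (hρ : IsPenalty ρ) {s t : ℝ} (h : |s| ≤ |t|) : ρ s ≤ ρ t := by
  rw [← hρ.map_abs s, ← hρ.map_abs t]
  exact hρ.mono (abs_nonneg s) (abs_nonneg t) h

theorem nonneg (hρ : IsPenalty ρ) (t : ℝ) : 0 ≤ ρ t :=
  hρ.zero ▸ hρ.le_of_abs_le (by simp)

theorem add_le (hρ : IsPenalty ρ) (s t : ℝ) : ρ (s + t) ≤ ρ s + ρ t := by
  rw [← hρ.map_abs s, ← hρ.map_abs t]
  refine (hρ.le_of_abs_le ?_).trans (hρ.subadd _ _ (abs_nonneg s) (abs_nonneg t))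
  exact (abs_add_le s t).trans (le_abs_self _)

theorem sub_le (hρ : IsPenalty ρ) (s t : ℝ) : ρ s - ρ t ≤ ρ (s - t) := by
  simpa [sub_le_iff_le_add] using hρ.add_le (s - t) t

theorem nat_mul_le (hρ : IsPenalty ρ) (k : ℕ) (t : ℝ) : ρ (k * t) ≤ k * ρ t := by
  induction k with
  | zero => simp [hρ.zero]
  | succ k ih =>
    rw [Nat.cast_succ, add_one_mul, add_one_mul]
    exact (hρ.add_le _ _).trans (by gcongr)

theorem le_div_add_one_mul (hρ : IsPenalty ρ) {s t : ℝ} (hs : 0 ≤ s) (ht : 0 < t) :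
    ρ s ≤ (s / t + 1) * ρ t :=
  calc ρ s ≤ ρ (⌈s / t⌉₊ * t) :=
        hρ.mono hs (Set.mem_Ici.2 (by positivity)) ((div_le_iff₀ ht).1 (Nat.le_ceil _))
    _ ≤ ⌈s / t⌉₊ * ρ t := hρ.nat_mul_le _ _
    _ ≤ (s / t + 1) * ρ t :=
        mul_le_mul_of_nonneg_right (Nat.ceil_lt_add_one (by positivity)).le (hρ.nonneg t)

theorem pos_of_ne_zero (hρ : IsPenalty ρ) {s : ℝ} (hs : 0 < ρ s) {t : ℝ} (ht : t ≠ 0) :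
    0 < ρ t := by
  have hle := hρ.le_div_add_one_mul (abs_nonneg s) (abs_pos.2 ht)
  rw [hρ.map_abs, hρ.map_abs] at hle
  exact pos_of_mul_pos_right (hs.trans_le hle) (by positivity)

theorem threshold_le (hρ : IsPenalty ρ) {t : ℝ} (ht : 0 < t) :
    threshold ρ ≤ t / 2 + ρ t / t := by
  refine csInf_le ⟨0, ?_⟩ ⟨t, ht, rfl⟩
  rintro _ ⟨s, hs : 0 < s, rfl⟩
  have := hρ.nonneg s
  positivity

theorem le_threshold {c : ℝ} (h : ∀ t, 0 < t → c ≤ t / 2 + ρ t / t) : c ≤ threshold ρ :=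
  le_csInf (Set.nonempty_Ioi.image _) (Set.forall_mem_image.2 h)

theorem threshold_nonneg (hρ : IsPenalty ρ) : 0 ≤ threshold ρ := by
  refine le_threshold fun t ht => ?_
  have := hρ.nonneg t
  positivity

theorem threshold_pos (hρ : IsPenalty ρ) {s : ℝ} (hs : 0 < ρ s) : 0 < threshold ρ := by
  have hone : 0 < ρ 1 := hρ.pos_of_ne_zero hs one_ne_zero
  refine lt_of_lt_of_le (b := min (1 / 2) (ρ 1 / 2)) (by positivity) (le_threshold fun t ht => ?_)
  have hdiv : 0 ≤ ρ t / t := div_nonneg (hρ.nonneg t) ht.le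
  rcases le_total t 1 with ht1 | ht1
  · have hle : ρ 1 ≤ ρ t / t + ρ t := by
      simpa [add_mul, div_eq_inv_mul] using hρ.le_div_add_one_mul zero_le_one ht
    have : ρ t ≤ ρ t / t := le_div_self (hρ.nonneg t) ht ht1
    exact (min_le_right _ _).trans (by linarith)
  · exact (min_le_left _ _).trans (by linarith)

theorem exists_pos_of_threshold_pos (hρ : IsPenalty ρ) (h : 0 < threshold ρ) :
    ∃ s, 0 < ρ s := by
  by_contra! hnonpos
  have hle := hρ.threshold_le h
  have := div_nonpos_of_nonpos_of_nonneg (hnonpos (threshold ρ)) h.le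
  linarith

theorem continuousAt (hρ : IsPenalty ρ) (hd : LRDifferentiable ρ) {t : ℝ} (ht : t ≠ 0) :
    ContinuousAt ρ t := by
  have hpos : ContinuousAt ρ |t| :=
    continuousAt_iff_continuous_left'_right'.2
      ⟨(hd _ (abs_pos.2 ht)).1.continuousWithinAt, (hd _ (abs_pos.2 ht)).2.continuousWithinAt⟩
  simpa only [Function.comp_def, hρ.map_abs] using hpos.comp continuous_abs.continuousAt

theorem lowerSemicontinuous (hρ : IsPenalty ρ) (hd : LRDifferentiable ρ) :
    LowerSemicontinuous ρ := by
  intro t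
  rcases eq_or_ne t 0 with rfl | ht
  · intro c hc
    exact Eventually.of_forall fun s => (hρ.zero ▸ hc).trans_le (hρ.nonneg s)
  · exact (hρ.continuousAt hd ht).lowerSemicontinuousAt

end IsPenalty

/-! ### One-sided slopes and admissible derivative values -/

theorem coe_le_of_tendsto {l : Filter ℝ} [l.NeBot] {f q : ℝ → ℝ} {c : ℝ} {a : EReal}
    (hf : Tendsto f l (𝓝 c)) (hq : Tendsto (fun s => (q s : EReal)) l (𝓝 a))
    (hle : ∀ᶠ s in l, f s ≤ q s) : (c : EReal) ≤ a :=
  le_of_tendsto_of_tendsto (EReal.tendsto_coe.2 hf) hq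
    (hle.mono fun _ hs => EReal.coe_le_coe_iff.2 hs)

theorem le_coe_of_tendsto {l : Filter ℝ} [l.NeBot] {f q : ℝ → ℝ} {c : ℝ} {a : EReal}
    (hf : Tendsto f l (𝓝 c)) (hq : Tendsto (fun s => (q s : EReal)) l (𝓝 a))
    (hle : ∀ᶠ s in l, q s ≤ f s) : a ≤ (c : EReal) :=
  le_of_tendsto_of_tendsto hq (EReal.tendsto_coe.2 hf)
    (hle.mono fun _ hs => EReal.coe_le_coe_iff.2 hs)

theorem tendsto_sub_half_nhds_zero (c : ℝ) :
    Tendsto (fun s : ℝ => c - s / 2) (𝓝 0) (𝓝 c) := by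
  have : Continuous fun s : ℝ => c - s / 2 := by fun_prop
  simpa using this.tendsto 0

theorem hasLeftSlope_neg_iff (hρ : IsPenalty ρ) {t : ℝ} {a : EReal} :
    HasLeftSlope ρ (-t) (-a) ↔ HasRightSlope ρ t a := by
  have hmap : 𝓝[<] (0 : ℝ) = map Neg.neg (𝓝[>] 0) := by simp
  have hquot (s : ℝ) : (ρ (-t + -s) - ρ (-t)) / -s = -((ρ (t + s) - ρ t) / s) := by
    rw [← neg_add, hρ.even, hρ.even, div_neg]
  rw [HasLeftSlope, hmap, tendsto_map'_iff]
  simp only [Function.comp_def, hquot, EReal.coe_neg]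
  constructor <;> intro h
  · simpa only [HasRightSlope, Function.comp_def, neg_neg] using (continuous_neg.tendsto _).comp h
  · exact (continuous_neg.tendsto _).comp h

theorem neg_mem_pdot (hρ : IsPenalty ρ) {t d : ℝ} (h : d ∈ pdot ρ t) : -d ∈ pdot ρ (-t) := by
  obtain ⟨a, b, ha, hb, hmin, hmax⟩ := h
  refine ⟨-b, -a, (hasLeftSlope_neg_iff hρ).2 hb,
    (hasLeftSlope_neg_iff hρ).1 (by simpa only [neg_neg] using ha), ?_, ?_⟩
  · simpa only [EReal.coe_neg, min_le_iff, EReal.neg_le_neg_iff] using (le_max_iff.1 hmax).symm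
  · simpa only [EReal.coe_neg, le_max_iff, EReal.neg_le_neg_iff] using (min_le_iff.1 hmin).symm

theorem mem_pdot_of_forall_le {t c : ℝ} {a b : EReal} (ha : HasLeftSlope ρ t a)
    (hb : HasRightSlope ρ t b) (h : ∀ s, c * s ≤ ρ (t + s) - ρ t + s ^ 2 / 2) :
    c ∈ pdot ρ t := by
  have hlim := tendsto_sub_half_nhds_zero c
  have hac : a ≤ (c : EReal) := by
    refine le_coe_of_tendsto (hlim.mono_left nhdsWithin_le_nhds) ha ?_
    filter_upwards [self_mem_nhdsWithin] with s (hs : s < 0)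
    rw [div_le_iff_of_neg hs]
    linarith [h s]
  have hcb : (c : EReal) ≤ b := by
    refine coe_le_of_tendsto (hlim.mono_left nhdsWithin_le_nhds) hb ?_
    filter_upwards [self_mem_nhdsWithin] with s (hs : 0 < s)
    rw [le_div_iff₀ hs]
    linarith [h s]
  exact ⟨a, b, ha, hb, min_le_of_left_le hac, le_max_of_le_right hcb⟩

theorem mem_pdot_zero (hρ : IsPenalty ρ) {D : EReal} (hD : HasRightSlope ρ 0 D) {d : ℝ}
    (hd : ((|d| : ℝ) : EReal) ≤ D) : d ∈ pdot ρ 0 := by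
  refine ⟨-D, D, by simpa using (hasLeftSlope_neg_iff hρ).2 hD, hD, min_le_of_left_le ?_,
    le_max_of_le_right ((EReal.coe_le_coe_iff.2 (le_abs_self d)).trans hd)⟩
  rw [EReal.neg_le, ← EReal.coe_neg]
  exact (EReal.coe_le_coe_iff.2 (neg_le_abs d)).trans hd

theorem threshold_le_rightSlope (hρ : IsPenalty ρ) {D : EReal} (hD : HasRightSlope ρ 0 D) :
    (threshold ρ : EReal) ≤ D := by
  refine coe_le_of_tendsto ((tendsto_sub_half_nhds_zero _).mono_left nhdsWithin_le_nhds) hD ?_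
  filter_upwards [self_mem_nhdsWithin] with s (hs : 0 < s)
  rw [zero_add, hρ.zero, sub_zero]
  linarith [hρ.threshold_le hs]

/- Subadditivity gives `ρ t / t ≥ ρ s / (s + t)`, so `ρ t / t` tends to its supremum as `t → 0+`. -/
theorem exists_hasRightSlope_zero (hρ : IsPenalty ρ) : ∃ D, HasRightSlope ρ 0 D := by
  refine ⟨⨆ s ∈ Set.Ioi (0 : ℝ), ((ρ s / s : ℝ) : EReal), tendsto_order.2 ⟨fun c hc => ?_,
    fun c hc => ?_⟩⟩
  · obtain ⟨s, hs, hcs⟩ := lt_biSup_iff.1 hc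
    rw [Set.mem_Ioi] at hs
    have hlim : Tendsto (fun t => ((ρ s / (s + t) : ℝ) : EReal)) (𝓝[>] 0)
        (𝓝 ((ρ s / s : ℝ) : EReal)) := by
      refine EReal.tendsto_coe.2 (tendsto_nhdsWithin_of_tendsto_nhds ?_)
      have : ContinuousAt (fun t => ρ s / (s + t)) 0 := by
        fun_prop (disch := simpa using hs.ne')
      simpa [ContinuousAt] using this
    filter_upwards [hlim.eventually (lt_mem_nhds hcs), self_mem_nhdsWithin] with t hct (ht : 0 < t)
    refine hct.trans_le (EReal.coe_le_coe_iff.2 ?_)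
    rw [zero_add, hρ.zero, sub_zero, div_le_div_iff₀ (by positivity) ht]
    calc ρ s * t ≤ (s / t + 1) * ρ t * t := by gcongr; exact hρ.le_div_add_one_mul hs.le ht
      _ = ρ t * (s + t) := by field_simp
  · filter_upwards [self_mem_nhdsWithin] with t ht
    refine lt_of_le_of_lt ?_ hc
    rw [zero_add, hρ.zero, sub_zero]
    exact le_biSup (fun s => ((ρ s / s : ℝ) : EReal)) ht

theorem exists_hasLeftSlope (hd : LRDifferentiable ρ) {t : ℝ} (ht : 0 < t) :
    ∃ a, HasLeftSlope ρ t a := by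
  have hmap : Tendsto (fun s => t + s) (𝓝[<] 0) (𝓝[<] t) := by
    refine tendsto_nhdsWithin_iff.2 ⟨tendsto_nhdsWithin_of_tendsto_nhds ?_, ?_⟩
    · simpa using (continuous_const_add t).tendsto 0
    · filter_upwards [self_mem_nhdsWithin] with s (hs : s < 0) using by simpa using hs
  have hslope := (hasDerivWithinAt_iff_tendsto_slope' (by simp)).1 (hd t ht).1.hasDerivWithinAt
  exact ⟨_, EReal.tendsto_coe.2 (by
    simpa [Function.comp_def, slope_def_field] using hslope.comp hmap)⟩

theorem exists_hasRightSlope (hd : LRDifferentiable ρ) {t : ℝ} (ht : 0 < t) :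
    ∃ b, HasRightSlope ρ t b := by
  have hmap : Tendsto (fun s => t + s) (𝓝[>] 0) (𝓝[>] t) := by
    refine tendsto_nhdsWithin_iff.2 ⟨tendsto_nhdsWithin_of_tendsto_nhds ?_, ?_⟩
    · simpa using (continuous_const_add t).tendsto 0
    · filter_upwards [self_mem_nhdsWithin] with s (hs : 0 < s) using by simpa using hs
  have hslope := (hasDerivWithinAt_iff_tendsto_slope' (by simp)).1 (hd t ht).2.hasDerivWithinAt
  exact ⟨_, EReal.tendsto_coe.2 (by
    simpa [Function.comp_def, slope_def_field] using hslope.comp hmap)⟩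

theorem exists_slopes (hρ : IsPenalty ρ) (hd : LRDifferentiable ρ) (t : ℝ) :
    ∃ a b : EReal, HasLeftSlope ρ t a ∧ HasRightSlope ρ t b := by
  rcases lt_trichotomy t 0 with ht | rfl | ht
  · obtain ⟨a, ha⟩ := exists_hasLeftSlope hd (neg_pos.2 ht)
    obtain ⟨b, hb⟩ := exists_hasRightSlope hd (neg_pos.2 ht)
    exact ⟨-b, -a, by simpa using (hasLeftSlope_neg_iff hρ).2 hb,
      (hasLeftSlope_neg_iff hρ).1 (by simpa using ha)⟩
  · obtain ⟨D, hD⟩ := exists_hasRightSlope_zero hρ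
    exact ⟨-D, D, by simpa using (hasLeftSlope_neg_iff hρ).2 hD, hD⟩
  · obtain ⟨a, ha⟩ := exists_hasLeftSlope hd ht
    obtain ⟨b, hb⟩ := exists_hasRightSlope hd ht
    exact ⟨a, b, ha, hb⟩

theorem le_of_mem_pdot {t c d : ℝ} (hd : d ∈ pdot ρ t)
    (hc : ∀ᶠ s in 𝓝[≠] 0, c ≤ (ρ (t + s) - ρ t) / s) : c ≤ d := by
  obtain ⟨a, b, ha, hb, hmin, -⟩ := hd
  have hca := coe_le_of_tendsto tendsto_const_nhds ha (hc.filter_mono (nhdsLT_le_nhdsNE 0))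
  have hcb := coe_le_of_tendsto tendsto_const_nhds hb (hc.filter_mono (nhdsGT_le_nhdsNE 0))
  exact EReal.coe_le_coe_iff.1 ((le_min hca hcb).trans hmin)

theorem ge_of_mem_pdot {t c d : ℝ} (hd : d ∈ pdot ρ t)
    (hc : ∀ᶠ s in 𝓝[≠] 0, (ρ (t + s) - ρ t) / s ≤ c) : d ≤ c := by
  obtain ⟨a, b, ha, hb, -, hmax⟩ := hd
  have hac := le_coe_of_tendsto tendsto_const_nhds ha (hc.filter_mono (nhdsLT_le_nhdsNE 0))
  have hbc := le_coe_of_tendsto tendsto_const_nhds hb (hc.filter_mono (nhdsGT_le_nhdsNE 0))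
  exact EReal.coe_le_coe_iff.1 (hmax.trans (max_le hac hbc))

theorem slope_le_of_mem_pdot (hc : ConcaveOn ℝ (Set.Ioi 0) ρ) {s t d : ℝ} (hs : 0 < s)
    (hst : s < t) (hd : d ∈ pdot ρ s) : slope ρ s t ≤ d := by
  refine le_of_mem_pdot hd ?_
  filter_upwards [self_mem_nhdsWithin, mem_nhdsWithin_of_mem_nhds
    (Ioo_mem_nhds (neg_lt_zero.2 hs) (sub_pos.2 hst))] with h (hne : h ≠ 0) ⟨hlow, hupp⟩
  have := hc.slope_anti (Set.mem_Ioi.2 hs) (a := s + h) (b := t)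
    ⟨neg_lt_iff_pos_add'.1 hlow, by simpa using hne⟩ ⟨hs.trans hst, hst.ne'⟩
    (lt_sub_iff_add_lt'.1 hupp).le
  rwa [slope_def_field (b := s + h), add_sub_cancel_left] at this

theorem le_slope_of_mem_pdot (hc : ConcaveOn ℝ (Set.Ioi 0) ρ) {s t d : ℝ} (hs : 0 < s)
    (hst : s < t) (hd : d ∈ pdot ρ t) : d ≤ slope ρ s t := by
  refine ge_of_mem_pdot hd ?_
  filter_upwards [self_mem_nhdsWithin, mem_nhdsWithin_of_mem_nhds
    (Ioi_mem_nhds (sub_neg.2 hst))] with h (hne : h ≠ 0) (hlow : s - t < h)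
  have hle : s ≤ t + h := (sub_lt_iff_lt_add'.1 hlow).le
  have := hc.slope_anti (Set.mem_Ioi.2 (hs.trans hst)) (a := s) (b := t + h)
    ⟨hs, hst.ne⟩ ⟨hs.trans_le hle, by simpa using hne⟩ hle
  rwa [slope_comm ρ t s, slope_def_field (b := t + h), add_sub_cancel_left] at this

theorem mul_le_of_mem_pdot (hρ : IsPenalty ρ) (hc : ConcaveOn ℝ (Set.Ioi 0) ρ) {t d : ℝ}
    (ht : 0 < t) (hd : d ∈ pdot ρ t) : d * t ≤ ρ t := by
  have hlim : Tendsto (fun s : ℝ => d * (t - s)) (𝓝[>] 0) (𝓝 (d * t)) := by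
    have : Continuous fun s : ℝ => d * (t - s) := by fun_prop
    simpa using (this.tendsto 0).mono_left nhdsWithin_le_nhds
  refine le_of_tendsto hlim ?_
  filter_upwards [Ioo_mem_nhdsGT ht] with s ⟨hs, hst⟩
  have := le_slope_of_mem_pdot hc hs hst hd
  rw [slope_def_field, le_div_iff₀ (sub_pos.2 hst)] at this
  linarith [hρ.nonneg s]

/-! ### The quadratic part of the loss -/

/-- The linear map `w ↦ Xᵀ w / n`. It sends the residual `X b - y` to the gradient of the quadratic
part of the loss, and `ε` to the score of the noise. -/
def score (X : Matrix (Fin n) (Fin p) ℝ) : (Fin n → ℝ) →ₗ[ℝ] Fin p → ℝ :=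
  (n : ℝ)⁻¹ • Xᵀ.mulVecLin

/-- The normalized quadratic form `‖X u‖₂² / n`. -/
def gramForm (X : Matrix (Fin n) (Fin p) ℝ) (u : Fin p → ℝ) : ℝ :=
  (∑ i, (X *ᵥ u) i ^ 2) / n

theorem score_apply (X : Matrix (Fin n) (Fin p) ℝ) (w : Fin n → ℝ) (j : Fin p) :
    score X w j = (Xᵀ *ᵥ w) j / n := by
  simp [score, div_eq_inv_mul, mulVec_transpose]

theorem sum_score_mul (X : Matrix (Fin n) (Fin p) ℝ) (w : Fin n → ℝ) (v : Fin p → ℝ) :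
    ∑ j, score X w j * v j = (∑ i, w i * (X *ᵥ v) i) / n := by
  have hdot : (Xᵀ *ᵥ w) ⬝ᵥ v = w ⬝ᵥ (X *ᵥ v) := by
    rw [mulVec_transpose, dotProduct_mulVec]
  simp only [score_apply, div_mul_eq_mul_div, ← Finset.sum_div]
  exact congrArg (· / (n : ℝ)) hdot

theorem gramForm_nonneg (X : Matrix (Fin n) (Fin p) ℝ) (u : Fin p → ℝ) : 0 ≤ gramForm X u := by
  unfold gramForm
  positivity

theorem gramForm_smul (X : Matrix (Fin n) (Fin p) ℝ) (c : ℝ) (u : Fin p → ℝ) :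
    gramForm X (c • u) = c ^ 2 * gramForm X u := by
  simp only [gramForm, mulVec_smul, Pi.smul_apply, smul_eq_mul, mul_pow, ← Finset.mul_sum,
    mul_div_assoc]

theorem gramForm_single (hn : 0 < n) {X : Matrix (Fin n) (Fin p) ℝ} {j : Fin p}
    (hX : ∑ i, X i j ^ 2 = n) (s : ℝ) : gramForm X (Pi.single j s) = s ^ 2 := by
  have hn' : (n : ℝ) ≠ 0 := Nat.cast_ne_zero.2 hn.ne'
  simp [gramForm, mulVec_single, mul_pow, ← Finset.sum_mul, hX, hn']

theorem sum_score_mul_sq_le (X : Matrix (Fin n) (Fin p) ℝ) (w : Fin n → ℝ) (v : Fin p → ℝ) :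
    (∑ j, score X w j * v j) ^ 2 ≤ (∑ i, w i ^ 2) / n * gramForm X v := by
  rw [sum_score_mul, gramForm, div_pow, div_mul_div_comm, ← sq]
  gcongr
  exact Finset.sum_mul_sq_le_sq_mul_sq _ _ _

theorem loss_add_sub_loss (X : Matrix (Fin n) (Fin p) ℝ) (y : Fin n → ℝ) (b v : Fin p → ℝ) :
    loss X y ρ (b + v) - loss X y ρ b = ∑ j, score X (X *ᵥ b - y) j * v j + gramForm X v / 2
      + ∑ j, (ρ (b j + v j) - ρ (b j)) := by
  have hsq : ∑ i, (y i - (X *ᵥ (b + v)) i) ^ 2 = ∑ i, (y i - (X *ᵥ b) i) ^ 2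
      + 2 * ∑ i, (X *ᵥ b - y) i * (X *ᵥ v) i + ∑ i, (X *ᵥ v) i ^ 2 := by
    rw [Finset.mul_sum, ← Finset.sum_add_distrib, ← Finset.sum_add_distrib]
    refine Finset.sum_congr rfl fun i _ => ?_
    rw [mulVec_add, Pi.add_apply, Pi.sub_apply]
    ring
  simp only [loss, hsq, sum_score_mul, gramForm, Finset.sum_sub_distrib, Pi.add_apply]
  ring

theorem loss_nonneg (hρ : IsPenalty ρ) (X : Matrix (Fin n) (Fin p) ℝ) (y : Fin n → ℝ)
    (b : Fin p → ℝ) : 0 ≤ loss X y ρ b :=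
  add_nonneg (by positivity) (Finset.sum_nonneg fun _ _ => hρ.nonneg _)

theorem map_le_loss (hρ : IsPenalty ρ) (X : Matrix (Fin n) (Fin p) ℝ) (y : Fin n → ℝ)
    (b : Fin p → ℝ) (j : Fin p) : ρ (b j) ≤ loss X y ρ b :=
  (Finset.single_le_sum (f := fun j => ρ (b j)) (fun _ _ => hρ.nonneg _) (Finset.mem_univ j)).trans
    (le_add_of_nonneg_left (by positivity))

theorem abs_mulVec_le_of_loss_le (hρ : IsPenalty ρ) (X : Matrix (Fin n) (Fin p) ℝ)
    (y : Fin n → ℝ) {b : Fin p → ℝ} {c : ℝ} (hb : loss X y ρ b ≤ c) (i : Fin n) :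
    |(X *ᵥ b) i| ≤ |y i| + √(2 * n * c) := by
  have hn : (0 : ℝ) < n := Nat.cast_pos.2 i.pos
  have hfit : (∑ i, (y i - (X *ᵥ b) i) ^ 2) / (2 * n) ≤ c :=
    (le_add_of_nonneg_right (Finset.sum_nonneg fun _ _ => hρ.nonneg _)).trans hb
  have hres : |y i - (X *ᵥ b) i| ≤ √(2 * n * c) := by
    refine Real.abs_le_sqrt ?_
    refine (Finset.single_le_sum (f := fun i => (y i - (X *ᵥ b) i) ^ 2)
      (fun _ _ => sq_nonneg _) (Finset.mem_univ i)).trans ?_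
    rwa [div_le_iff₀' (by positivity)] at hfit
  have := abs_sub_abs_le_abs_sub ((X *ᵥ b) i) (y i)
  rw [abs_sub_comm] at this
  linarith

/-! ### Existence of a global minimizer -/

theorem exists_tendsto_of_eventually_abs_le {α : Type*} {U : Ultrafilter α} {f : α → ℝ} {M : ℝ}
    (h : ∀ᶠ k in U, |f k| ≤ M) : ∃ c, Tendsto f U (𝓝 c) := by
  obtain ⟨c, -, hc⟩ := (isCompact_Icc (a := -M) (b := M)).ultrafilter_le_nhds (U.map f)
    (le_principal_iff.2 (h.mono fun k hk => abs_le.1 hk))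
  exact ⟨c, hc⟩

theorem tendsto_abs_atTop_of_not_exists_tendsto {α : Type*} {U : Ultrafilter α} {f : α → ℝ}
    (h : ¬ ∃ c, Tendsto f U (𝓝 c)) : Tendsto (fun k => |f k|) U atTop := by
  refine tendsto_atTop.2 fun M => ?_
  have : ¬ ∀ᶠ k in (U : Filter α), |f k| ≤ M := fun hM => h (exists_tendsto_of_eventually_abs_le hM)
  exact (Ultrafilter.eventually_not.2 this).mono fun k hk => (not_le.1 hk).le

/- The image of a coordinate subspace is closed, so the contribution of the diverging coordinates to
the limit can be attained by finite ones. -/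
theorem exists_mulVec_eq_of_tendsto {α : Type*} {U : Ultrafilter α}
    (X : Matrix (Fin n) (Fin p) ℝ) {b : α → Fin p → ℝ} {z : Fin n → ℝ}
    (hz : Tendsto (fun k => X *ᵥ b k) U (𝓝 z)) :
    ∃ a, X *ᵥ a = z ∧ ∀ j, Tendsto (fun k => b k j) U (𝓝 (a j)) ∨
      Tendsto (fun k => |b k j|) U atTop := by
  classical
  let A : Set (Fin p) := {j | ¬ ∃ c, Tendsto (fun k => b k j) U (𝓝 c)}
  have hconv : ∀ j, ∃ c, Tendsto (fun k => Aᶜ.indicator (b k) j) U (𝓝 c) := by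
    intro j
    by_cases hj : j ∈ A
    · exact ⟨0, by simp [hj]⟩
    · obtain ⟨c, hc⟩ := not_not.1 hj
      exact ⟨c, by simpa [hj] using hc⟩
  choose c hc using hconv
  let W : Submodule ℝ (Fin p → ℝ) := Submodule.pi Aᶜ fun _ => ⊥
  have hclosed : IsClosed ((W.map X.mulVecLin : Submodule ℝ (Fin n → ℝ)) : Set (Fin n → ℝ)) :=
    Submodule.closed_of_finiteDimensional _
  have hlim : Tendsto (fun k => X *ᵥ A.indicator (b k)) U (𝓝 (z - X *ᵥ c)) := by
    have hcont : Continuous fun v : Fin p → ℝ => X *ᵥ v := by fun_prop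
    refine (hz.sub ((hcont.tendsto c).comp (tendsto_pi_nhds.2 hc))).congr fun k => ?_
    rw [Function.comp_apply, ← mulVec_sub, sub_eq_iff_eq_add.2 (A.indicator_self_add_compl _).symm]
  obtain ⟨a, haW, ha⟩ : z - X *ᵥ c ∈ W.map X.mulVecLin :=
    hclosed.mem_of_tendsto hlim (Eventually.of_forall fun k =>
      ⟨A.indicator (b k), fun j hj => by simpa using fun h => absurd h hj, rfl⟩)
  have haA : ∀ j ∉ A, a j = 0 := fun j hj => by simpa using haW j hj
  refine ⟨a + c, by rw [mulVec_add, ← mulVecLin_apply, ha, sub_add_cancel], fun j => ?_⟩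
  by_cases hj : j ∈ A
  · exact Or.inr (tendsto_abs_atTop_of_not_exists_tendsto hj)
  · left
    simpa [hj, haA j hj] using hc j

theorem le_of_tendsto_penalty (hρ : IsPenalty ρ) (hd : LRDifferentiable ρ) {α : Type*}
    {l : Filter α} [l.NeBot] {f : α → ℝ} {a P : ℝ}
    (hf : Tendsto f l (𝓝 a) ∨ Tendsto (fun k => |f k|) l atTop)
    (hP : Tendsto (fun k => ρ (f k)) l (𝓝 P)) : ρ a ≤ P := by
  rcases hf with hf | hf
  · refine le_of_forall_lt_imp_le_of_dense fun c hc => ge_of_tendsto hP ?_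
    exact (hf.eventually (hρ.lowerSemicontinuous hd a c hc)).mono fun _ hk => le_of_lt hk
  · exact ge_of_tendsto hP ((hf.eventually_ge_atTop |a|).mono fun _ hk => hρ.le_of_abs_le hk)

theorem exists_isMinOn_loss (hρ : IsPenalty ρ) (hd : LRDifferentiable ρ)
    (X : Matrix (Fin n) (Fin p) ℝ) (y : Fin n → ℝ) :
    ∃ b, IsMinOn (loss X y ρ) Set.univ b := by
  set l := sInf (Set.range (loss X y ρ))
  have hbdd : BddBelow (Set.range (loss X y ρ)) := ⟨0, Set.forall_mem_range.2 (loss_nonneg hρ X y)⟩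
  obtain ⟨u, -, hu, hmem⟩ := exists_seq_tendsto_sInf (Set.range_nonempty (loss X y ρ)) hbdd
  choose b hb using hmem
  obtain rfl : (fun k => loss X y ρ (b k)) = u := funext hb
  let U : Ultrafilter ℕ := hyperfilter ℕ
  have hloss : Tendsto (fun k => loss X y ρ (b k)) U (𝓝 l) := hu.mono_left Nat.hyperfilter_le_atTop
  have hle : ∀ᶠ k in U, loss X y ρ (b k) ≤ l + 1 :=
    (hloss.eventually_lt_const (lt_add_one l)).mono fun _ hk => le_of_lt hk
  have hfit : ∀ i, ∃ z, Tendsto (fun k => (X *ᵥ b k) i) U (𝓝 z) := fun i =>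
    exists_tendsto_of_eventually_abs_le (hle.mono fun _ hk => abs_mulVec_le_of_loss_le hρ X y hk i)
  have hpen : ∀ j, ∃ P, Tendsto (fun k => ρ (b k j)) U (𝓝 P) := fun j =>
    exists_tendsto_of_eventually_abs_le (hle.mono fun k hk => by
      rw [abs_of_nonneg (hρ.nonneg _)]
      exact (map_le_loss hρ X y (b k) j).trans hk)
  choose z hz using hfit
  choose P hP using hpen
  obtain ⟨a, rfl, ha⟩ := exists_mulVec_eq_of_tendsto X (tendsto_pi_nhds.2 hz)
  have hlim : Tendsto (fun k => loss X y ρ (b k)) U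
      (𝓝 ((∑ i, (y i - (X *ᵥ a) i) ^ 2) / (2 * n) + ∑ j, P j)) :=
    ((tendsto_finsetSum _ fun i _ => ((hz i).const_sub (y i)).pow 2).div_const _).add
      (tendsto_finsetSum _ fun j _ => hP j)
  have hmin : loss X y ρ a ≤ l := by
    rw [tendsto_nhds_unique hloss hlim, loss]
    gcongr with j
    exact le_of_tendsto_penalty hρ hd (ha j) (hP j)
  exact ⟨a, fun b' _ => hmin.trans (csInf_le hbdd ⟨b', rfl⟩)⟩

/-! ### First-order conditions at a global minimizer -/

theorem coordinate_le_of_isMinOn (hn : 0 < n) {X : Matrix (Fin n) (Fin p) ℝ} {j : Fin p}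
    (hX : ∑ i, X i j ^ 2 = n) {y : Fin n → ℝ} {b : Fin p → ℝ}
    (hb : IsMinOn (loss X y ρ) Set.univ b) (s : ℝ) :
    -score X (X *ᵥ b - y) j * s ≤ ρ (b j + s) - ρ (b j) + s ^ 2 / 2 := by
  have hmin : 0 ≤ loss X y ρ (b + Pi.single j s) - loss X y ρ b :=
    sub_nonneg.2 (hb (Set.mem_univ _))
  have hpen : ∑ k, (ρ (b k + (Pi.single j s : Fin p → ℝ) k) - ρ (b k)) = ρ (b j + s) - ρ (b j) := by
    rw [Finset.sum_eq_single j (fun k _ hk => by simp [hk]) (by simp), Pi.single_eq_same]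
  have hlin : ∑ k, score X (X *ᵥ b - y) k * (Pi.single j s : Fin p → ℝ) k
      = score X (X *ᵥ b - y) j * s := by
    rw [Finset.sum_eq_single j (fun k _ hk => by simp [hk]) (by simp), Pi.single_eq_same]
  rw [loss_add_sub_loss, hlin, hpen, gramForm_single hn hX] at hmin
  linarith

theorem abs_score_le_threshold (hn : 0 < n) (hρ : IsPenalty ρ)
    {X : Matrix (Fin n) (Fin p) ℝ} {j : Fin p} (hX : ∑ i, X i j ^ 2 = n) {y : Fin n → ℝ}
    {b : Fin p → ℝ} (hb : IsMinOn (loss X y ρ) Set.univ b) :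
    |score X (X *ᵥ b - y) j| ≤ threshold ρ := by
  have hcoord (s : ℝ) : -score X (X *ᵥ b - y) j * s ≤ ρ s + s ^ 2 / 2 :=
    (coordinate_le_of_isMinOn hn hX hb s).trans (by linarith [hρ.add_le (b j) s])
  refine IsPenalty.le_threshold fun t ht => ?_
  have hmul : |score X (X *ᵥ b - y) j| * t ≤ ρ t + t ^ 2 / 2 := by
    have hneg := hcoord (-t)
    rw [hρ.even, neg_sq] at hneg
    rcases abs_choice (score X (X *ᵥ b - y) j) with h | h <;> rw [h]
    · linarith
    · exact hcoord t
  calc |score X (X *ᵥ b - y) j| ≤ (ρ t + t ^ 2 / 2) / t := (le_div_iff₀ ht).2 hmul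
    _ = t / 2 + ρ t / t := by field_simp; ring

theorem neg_score_mem_pdot (hn : 0 < n) (hρ : IsPenalty ρ) (hd : LRDifferentiable ρ)
    {X : Matrix (Fin n) (Fin p) ℝ} {j : Fin p} (hX : ∑ i, X i j ^ 2 = n) {y : Fin n → ℝ}
    {b : Fin p → ℝ} (hb : IsMinOn (loss X y ρ) Set.univ b) :
    -score X (X *ᵥ b - y) j ∈ pdot ρ (b j) := by
  obtain ⟨a, c, ha, hc⟩ := exists_slopes hρ hd (b j)
  exact mem_pdot_of_forall_le ha hc (coordinate_le_of_isMinOn hn hX hb)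

/-! ### Null-consistency and the cone -/

theorem NullConsistent.isMinOn (hρ : IsPenalty ρ) {X : Matrix (Fin n) (Fin p) ℝ}
    {ε : Fin n → ℝ} {η : ℝ} (h : NullConsistent X ε ρ η) :
    IsMinOn (loss X (η⁻¹ • ε) ρ) Set.univ 0 := by
  intro b _
  simpa [loss, hρ.zero, div_eq_inv_mul] using h.2 ⟨b, rfl⟩

theorem NullConsistent.sum_score_mul_le (hρ : IsPenalty ρ) {X : Matrix (Fin n) (Fin p) ℝ}
    {ε : Fin n → ℝ} {η : ℝ} (hη : 0 < η) (h : NullConsistent X ε ρ η) (u : Fin p → ℝ) :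
    ∑ j, score X ε j * u j ≤ η * (gramForm X u / 2 + ∑ j, ρ (u j)) := by
  have hmin : 0 ≤ loss X (η⁻¹ • ε) ρ (0 + u) - loss X (η⁻¹ • ε) ρ 0 :=
    sub_nonneg.2 (h.isMinOn hρ (Set.mem_univ _))
  rw [loss_add_sub_loss] at hmin
  simp only [mulVec_zero, zero_sub, map_neg, map_smul, Pi.neg_apply, Pi.smul_apply, smul_eq_mul,
    neg_mul, Finset.sum_neg_distrib, mul_assoc, ← Finset.mul_sum, Pi.zero_apply, zero_add, hρ.zero,
    sub_zero] at hmin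
  rw [← inv_mul_le_iff₀ hη]
  linarith

theorem NullConsistent.abs_score_le (hn : 0 < n) (hρ : IsPenalty ρ)
    {X : Matrix (Fin n) (Fin p) ℝ} {j : Fin p} (hX : ∑ i, X i j ^ 2 = n)
    {ε : Fin n → ℝ} {η : ℝ} (hη : 0 < η) (h : NullConsistent X ε ρ η) :
    |score X ε j| ≤ η * threshold ρ := by
  have hle := abs_score_le_threshold hn hρ hX (h.isMinOn hρ)
  rw [mulVec_zero, zero_sub, map_neg, map_smul, Pi.neg_apply, Pi.smul_apply, smul_eq_mul, abs_neg,
    abs_mul, abs_inv, abs_of_pos hη] at hle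
  exact (inv_mul_le_iff₀ hη).1 hle

theorem one_lt_xi {η : ℝ} (hη : 0 < η) (hη1 : η < 1) : 1 < xi η := by
  rw [xi, one_lt_div (by linarith)]
  linarith

theorem basic_inequality (hρ : IsPenalty ρ) {X : Matrix (Fin n) (Fin p) ℝ}
    {β u : Fin p → ℝ} {ε : Fin n → ℝ} {S : Finset (Fin p)} (hβ : ∀ j ∉ S, β j = 0)
    (hle : loss X (X *ᵥ β + ε) ρ (β + u) ≤ loss X (X *ᵥ β + ε) ρ β) :
    gramForm X u / 2 + ∑ j ∈ Sᶜ, ρ (u j) ≤ ∑ j, score X ε j * u j + ∑ j ∈ S, ρ (u j) := by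
  have hexp := loss_add_sub_loss (ρ := ρ) X (X *ᵥ β + ε) β u
  rw [sub_add_cancel_left, map_neg] at hexp
  simp only [Pi.neg_apply, neg_mul, Finset.sum_neg_distrib] at hexp
  rw [← Finset.sum_add_sum_compl S fun j => ρ (β j + u j) - ρ (β j)] at hexp
  have hoff : ∑ j ∈ Sᶜ, (ρ (β j + u j) - ρ (β j)) = ∑ j ∈ Sᶜ, ρ (u j) :=
    Finset.sum_congr rfl fun j hj => by
      rw [hβ j (Finset.mem_compl.1 hj), hρ.zero, zero_add, sub_zero]
  have hon : -∑ j ∈ S, ρ (u j) ≤ ∑ j ∈ S, (ρ (β j + u j) - ρ (β j)) := by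
    rw [← Finset.sum_neg_distrib]
    refine Finset.sum_le_sum fun j _ => ?_
    have := hρ.sub_le (β j) (β j + u j)
    rw [sub_add_cancel_left, hρ.even] at this
    linarith
  linarith

theorem cone_inequality (hρ : IsPenalty ρ) {X : Matrix (Fin n) (Fin p) ℝ}
    {β u : Fin p → ℝ} {ε : Fin n → ℝ} {S : Finset (Fin p)} (hβ : ∀ j ∉ S, β j = 0)
    (hle : loss X (X *ᵥ β + ε) ρ (β + u) ≤ loss X (X *ᵥ β + ε) ρ β) {η : ℝ} (hη : 0 < η)
    (hη1 : η < 1) (hnull : NullConsistent X ε ρ η) :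
    gramForm X u / 2 + ∑ j ∈ Sᶜ, ρ (u j) ≤ xi η * ∑ j ∈ S, ρ (u j) := by
  have hbasic := basic_inequality hρ hβ hle
  have hnoise := hnull.sum_score_mul_le hρ hη u
  rw [← Finset.sum_add_sum_compl S fun j => ρ (u j)] at hnoise
  rw [xi, div_mul_eq_mul_div, le_div_iff₀ (by linarith)]
  linarith

theorem cone_inequality_strict (hρ : IsPenalty ρ) {t : ℝ} (ht : 0 < ρ t)
    {X : Matrix (Fin n) (Fin p) ℝ} {β u : Fin p → ℝ} {ε : Fin n → ℝ} {S : Finset (Fin p)}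
    (hβ : ∀ j ∉ S, β j = 0) (hle : loss X (X *ᵥ β + ε) ρ (β + u) ≤ loss X (X *ᵥ β + ε) ρ β)
    {η : ℝ} (hη : 0 < η) (hη1 : η < 1) (hnull : NullConsistent X ε ρ η) (hu : u ≠ 0) :
    ∑ j ∈ Sᶜ, ρ (u j) < xi η * ∑ j ∈ S, ρ (u j) := by
  have hcone := cone_inequality hρ hβ hle hη hη1 hnull
  rcases (gramForm_nonneg X u).eq_or_lt with hgram | hgram
  · have hnoise : ∑ j, score X ε j * u j = 0 := by
      have := sum_score_mul_sq_le X ε u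
      rw [← hgram, mul_zero] at this
      exact pow_eq_zero_iff two_ne_zero |>.1 (this.antisymm (sq_nonneg _))
    have hbasic := basic_inequality hρ hβ hle
    rw [hnoise, ← hgram] at hbasic
    obtain ⟨j, hj⟩ := Function.ne_iff.1 hu
    have htotal : 0 < ∑ j ∈ S, ρ (u j) + ∑ j ∈ Sᶜ, ρ (u j) := by
      rw [Finset.sum_add_sum_compl S fun j => ρ (u j)]
      exact Finset.sum_pos' (fun _ _ => hρ.nonneg _)
        ⟨j, Finset.mem_univ j, hρ.pos_of_ne_zero ht hj⟩
    calc ∑ j ∈ Sᶜ, ρ (u j) ≤ ∑ j ∈ S, ρ (u j) := by linarith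
      _ < xi η * ∑ j ∈ S, ρ (u j) := lt_mul_left (by linarith) (one_lt_xi hη hη1)
  · linarith

/-! ### The quantities `Δ` and `RIF₁` -/

/- The constraint `‖b‖₀ = k` in `Δ` is met exactly by shrinking `u` on `S` and spreading the freed
mass over the coordinates. -/
theorem exists_supp_eq_of_shrink (S : Finset (Fin p)) {u : Fin p → ℝ} (hu : u ≠ 0) {δ : ℝ}
    (hδ : 0 < δ) (hδ1 : δ < 1) : ∃ b : Fin p → ℝ, supp b = S ∧ ∑ j, |b j| ≤ ∑ j, |u j| ∧
      ∀ j ∈ S, |(1 - δ) * u j| ≤ |b j| := by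
  classical
  obtain ⟨i, hi⟩ := Function.ne_iff.1 hu
  have hp : (0 : ℝ) < p := Nat.cast_pos.2 i.pos
  set T := ∑ j, |u j| with hTdef
  have hT : 0 < T := Finset.sum_pos' (fun _ _ => abs_nonneg _) ⟨i, Finset.mem_univ i, abs_pos.2 hi⟩
  let w : Fin p → ℝ := fun j => (1 - δ) * |u j| + δ * (T / p)
  have hshrink (j : Fin p) : |(1 - δ) * u j| = (1 - δ) * |u j| := by
    rw [abs_mul, abs_of_pos (sub_pos.2 hδ1)]
  have hw (j : Fin p) : |(1 - δ) * u j| < w j := by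
    rw [hshrink]
    exact lt_add_of_pos_right _ (by positivity)
  have hw0 (j : Fin p) : 0 < w j := (abs_nonneg _).trans_lt (hw j)
  have hsum : ∑ j, w j = T := by
    rw [Finset.sum_add_distrib, ← Finset.mul_sum, Finset.sum_const, Finset.card_univ,
      Fintype.card_fin, nsmul_eq_mul, ← hTdef]
    field_simp
    ring
  refine ⟨fun j => if j ∈ S then w j else 0, ?_, ?_, fun j hj => ?_⟩
  · ext j
    simp [supp, (hw0 j).ne']
  · refine (Finset.sum_le_sum fun j _ => ?_).trans hsum.le
    by_cases hj : j ∈ S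
    · simp [hj, abs_of_pos (hw0 j)]
    · simpa [hj] using (hw0 j).le
  · simpa [hj, abs_of_pos (hw0 j)] using (hw j).le

theorem le_Delta {a : ENNReal} {b : Fin p → ℝ}
    (h : ENNReal.ofReal (∑ j, |b j|) ≤ a * (supp b).card) :
    ENNReal.ofReal (∑ j, ρ (b j)) ≤ Delta p ρ a (supp b).card :=
  le_iSup₂ (f := fun (b' : Fin p → ℝ) (_ : b' ∈ {b' : Fin p → ℝ |
    ENNReal.ofReal (∑ j, |b' j|) ≤ a * (supp b).card ∧ (supp b').card = (supp b).card}) =>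
      ENNReal.ofReal (∑ j, ρ (b' j))) b ⟨h, rfl⟩

theorem sum_le_toReal_Delta (hρ : IsPenalty ρ) (hd : LRDifferentiable ρ) {S : Finset (Fin p)}
    {u : Fin p → ℝ} {a : ENNReal} (h : ENNReal.ofReal (∑ j, |u j|) ≤ a * S.card)
    (hΔ : Delta p ρ a S.card ≠ ⊤) : ∑ j ∈ S, ρ (u j) ≤ (Delta p ρ a S.card).toReal := by
  rcases eq_or_ne u 0 with rfl | hu
  · simp [hρ.zero]
  have hshrunk : ∀ᶠ δ : ℝ in 𝓝[>] 0,
      ∑ j ∈ S, ρ ((1 - δ) * u j) ≤ (Delta p ρ a S.card).toReal := by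
    filter_upwards [Ioo_mem_nhdsGT one_pos] with δ ⟨hδ, hδ1⟩
    obtain ⟨b, rfl, hsum, hb⟩ := exists_supp_eq_of_shrink S hu hδ hδ1
    calc ∑ j ∈ supp b, ρ ((1 - δ) * u j) ≤ ∑ j ∈ supp b, ρ (b j) :=
          Finset.sum_le_sum fun j hj => hρ.le_of_abs_le (hb j hj)
      _ ≤ ∑ j, ρ (b j) := Finset.sum_le_univ_sum_of_nonneg fun _ => hρ.nonneg _
      _ ≤ (Delta p ρ a (supp b).card).toReal :=
          (ENNReal.ofReal_le_iff_le_toReal hΔ).1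
            (le_Delta ((ENNReal.ofReal_le_ofReal hsum).trans h))
  refine le_of_tendsto (tendsto_finsetSum _ fun j _ => ?_) hshrunk
  rcases eq_or_ne (u j) 0 with hj | hj
  · simp [hj]
  · have hcont : Continuous fun δ : ℝ => (1 - δ) * u j := by fun_prop
    refine (hρ.continuousAt hd hj).tendsto.comp ?_
    simpa using (hcont.tendsto 0).mono_left nhdsWithin_le_nhds

theorem RIF1_le (hn : 0 < n) {X : Matrix (Fin n) (Fin p) ℝ} {S : Finset (Fin p)}
    {u : Fin p → ℝ} {ξ t : ℝ} (hu : u ≠ 0) (ht : 0 ≤ t)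
    (hcone : ∑ j ∈ Sᶜ, ρ (u j) < ξ * ∑ j ∈ S, ρ (u j)) (hgrad : ∀ j, |score X (X *ᵥ u) j| ≤ t) :
    RIF1 X ρ ξ S ≤ ENNReal.ofReal (S.card * t / ∑ j, |u j|) := by
  have hn' : (0 : ℝ) < n := Nat.cast_pos.2 hn
  obtain ⟨i, hi⟩ := Function.ne_iff.1 hu
  have hT : 0 < ∑ j, |u j| :=
    Finset.sum_pos' (fun _ _ => abs_nonneg _) ⟨i, Finset.mem_univ i, abs_pos.2 hi⟩
  have hnorm : ‖Xᵀ *ᵥ (X *ᵥ u)‖ ≤ n * t := by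
    refine (pi_norm_le_iff_of_nonneg (by positivity)).2 fun j => ?_
    rw [← div_le_iff₀' hn', Real.norm_eq_abs, ← abs_of_pos hn', ← abs_div, ← score_apply]
    exact hgrad j
  refine (iInf₂_le (f := fun (u : Fin p → ℝ)
    (_ : u ∈ {u : Fin p → ℝ | ∑ j ∈ Sᶜ, ρ (u j) < ξ * ∑ j ∈ S, ρ (u j)}) =>
      ENNReal.ofReal (S.card * ‖Xᵀ *ᵥ (X *ᵥ u)‖ / (n * ∑ j, |u j|))) u hcone).trans
    (ENNReal.ofReal_le_ofReal ?_)
  calc S.card * ‖Xᵀ *ᵥ (X *ᵥ u)‖ / (n * ∑ j, |u j|)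
      ≤ S.card * (n * t) / (n * ∑ j, |u j|) := by gcongr
    _ = S.card * t / ∑ j, |u j| := by field_simp

theorem ofReal_le_ofReal_div_mul {c l k T : ℝ} {R : ENNReal} (hc : 0 < c) (hl : 0 < l) (hk : 0 < k)
    (hT : 0 < T) (hR : R ≤ ENNReal.ofReal (k * (c * l) / T)) :
    ENNReal.ofReal T ≤ ENNReal.ofReal c / R * ENNReal.ofReal l * ENNReal.ofReal k := by
  calc ENNReal.ofReal T
      = ENNReal.ofReal c / ENNReal.ofReal (k * (c * l) / T) * ENNReal.ofReal l
          * ENNReal.ofReal k := by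
        rw [← ENNReal.ofReal_div_of_pos (by positivity), ← ENNReal.ofReal_mul (by positivity),
          ← ENNReal.ofReal_mul (by positivity)]
        congr 1
        field_simp
    _ ≤ ENNReal.ofReal c / R * ENNReal.ofReal l * ENNReal.ofReal k := by gcongr

theorem sum_abs_le_of_cone (hn : 0 < n) {X : Matrix (Fin n) (Fin p) ℝ} {S : Finset (Fin p)}
    {u : Fin p → ℝ} {ξ c l : ℝ} (hu : u ≠ 0) (hS : S.Nonempty) (hc : 0 < c) (hl : 0 < l)
    (hcone : ∑ j ∈ Sᶜ, ρ (u j) < ξ * ∑ j ∈ S, ρ (u j))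
    (hgrad : ∀ j, |score X (X *ᵥ u) j| ≤ c * l) :
    ENNReal.ofReal (∑ j, |u j|)
      ≤ ENNReal.ofReal c / RIF1 X ρ ξ S * ENNReal.ofReal l * S.card := by
  obtain ⟨i, hi⟩ := Function.ne_iff.1 hu
  have hT : 0 < ∑ j, |u j| :=
    Finset.sum_pos' (fun _ _ => abs_nonneg _) ⟨i, Finset.mem_univ i, abs_pos.2 hi⟩
  rw [← ENNReal.ofReal_natCast]
  exact ofReal_le_ofReal_div_mul hc hl (Nat.cast_pos.2 hS.card_pos) hT
    (RIF1_le hn hu (by positivity) hcone hgrad)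

/-! ### Sparse eigenvalues -/

theorem sum_sq_pos {w : Fin p → ℝ} (hw : w ≠ 0) : 0 < ∑ j, w j ^ 2 := by
  obtain ⟨j, hj⟩ := Function.ne_iff.1 hw
  exact Finset.sum_pos' (fun _ _ => sq_nonneg _) ⟨j, Finset.mem_univ j, sq_pos_of_ne_zero hj⟩

theorem bddAbove_kappaPlus (X : Matrix (Fin n) (Fin p) ℝ) (m : ℝ) :
    BddAbove (gramForm X '' {u | ((supp u).card : ℝ) ≤ m ∧ ∑ j, u j ^ 2 = 1}) := by
  refine ⟨(∑ i, ∑ j, X i j ^ 2) / n, ?_⟩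
  rintro _ ⟨u, ⟨-, hu⟩, rfl⟩
  unfold gramForm
  gcongr with i
  have := Finset.sum_mul_sq_le_sq_mul_sq Finset.univ (X i) u
  rwa [hu, mul_one] at this

theorem kappaPlus_nonneg (X : Matrix (Fin n) (Fin p) ℝ) (m : ℝ) : 0 ≤ kappaPlus X m := by
  refine Real.sSup_nonneg ?_
  rintro _ ⟨u, -, rfl⟩
  exact gramForm_nonneg X u

theorem exists_normalized (X : Matrix (Fin n) (Fin p) ℝ) {w : Fin p → ℝ} (hw : w ≠ 0) :
    ∃ u : Fin p → ℝ, supp u = supp w ∧ ∑ j, u j ^ 2 = 1 ∧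
      gramForm X w = gramForm X u * ∑ j, w j ^ 2 := by
  have hpos := sum_sq_pos hw
  have hsq : √(∑ j, w j ^ 2) ^ 2 = ∑ j, w j ^ 2 := Real.sq_sqrt hpos.le
  refine ⟨(√(∑ j, w j ^ 2))⁻¹ • w, ?_, ?_, ?_⟩
  · ext j
    simp [supp, (Real.sqrt_pos.2 hpos).ne']
  · simp only [Pi.smul_apply, smul_eq_mul, mul_pow]
    rw [← Finset.mul_sum, inv_pow, hsq, inv_mul_cancel₀ hpos.ne']
  · rw [gramForm_smul, inv_pow, hsq]
    field_simp

theorem gramForm_le_kappaPlus_mul (X : Matrix (Fin n) (Fin p) ℝ) {m : ℝ} {w : Fin p → ℝ}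
    (hw : ((supp w).card : ℝ) ≤ m) : gramForm X w ≤ kappaPlus X m * ∑ j, w j ^ 2 := by
  rcases eq_or_ne w 0 with rfl | hw0
  · simp [gramForm]
  · obtain ⟨u, hsupp, hu1, hu⟩ := exists_normalized X hw0
    rw [hu]
    gcongr
    exact le_csSup (bddAbove_kappaPlus X m) ⟨u, ⟨by rwa [hsupp], hu1⟩, rfl⟩

theorem mul_lt_gramForm_of_lt_kappaMinus {X : Matrix (Fin n) (Fin p) ℝ} {m κ : ℝ}
    (hκ : 0 ≤ κ) (h : ENNReal.ofReal κ < kappaMinus X m) {w : Fin p → ℝ}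
    (hw : ((supp w).card : ℝ) ≤ m) (hw0 : w ≠ 0) : κ * ∑ j, w j ^ 2 < gramForm X w := by
  obtain ⟨u, hsupp, hu1, hu⟩ := exists_normalized X hw0
  have hlt : ENNReal.ofReal κ < ENNReal.ofReal (gramForm X u) :=
    h.trans_le (iInf₂_le (f := fun (u : Fin p → ℝ)
      (_ : u ∈ {u : Fin p → ℝ | ((supp u).card : ℝ) ≤ m ∧ ∑ j, u j ^ 2 = 1}) =>
        ENNReal.ofReal (gramForm X u)) u ⟨by rwa [hsupp], hu1⟩)
  rw [ENNReal.ofReal_lt_ofReal_iff_of_nonneg hκ] at hlt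
  rw [hu]
  exact mul_lt_mul_of_pos_right hlt (sum_sq_pos hw0)

theorem sum_score_sq_le (X : Matrix (Fin n) (Fin p) ℝ) {m : ℝ} {A : Finset (Fin p)}
    (hA : (A.card : ℝ) ≤ m) (v : Fin n → ℝ) :
    ∑ j ∈ A, score X v j ^ 2 ≤ kappaPlus X m * ((∑ i, v i ^ 2) / n) := by
  classical
  let w : Fin p → ℝ := fun j => if j ∈ A then score X v j else 0
  have hsupp : supp w ⊆ A := fun j hj => by
    by_contra hjA
    simp [supp, w, hjA] at hj
  have hcard : ((supp w).card : ℝ) ≤ m := (Nat.cast_le.2 (Finset.card_le_card hsupp)).trans hA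
  have hsq : ∑ j, w j ^ 2 = ∑ j ∈ A, score X v j ^ 2 := by
    simp [w, ite_pow]
  have hpair : ∑ j, score X v j * w j = ∑ j, w j ^ 2 :=
    Finset.sum_congr rfl fun j _ => by by_cases hj : j ∈ A <;> simp [w, hj, sq]
  have hκ := kappaPlus_nonneg X m
  rw [← hsq]
  rcases (Finset.sum_nonneg fun j _ => sq_nonneg (w j)).eq_or_lt with h | h
  · rw [← h]
    positivity
  · refine le_of_mul_le_mul_right ?_ h
    calc (∑ j, w j ^ 2) * ∑ j, w j ^ 2 = (∑ j, score X v j * w j) ^ 2 := by rw [hpair, sq]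
      _ ≤ (∑ i, v i ^ 2) / n * gramForm X w := sum_score_mul_sq_le X v w
      _ ≤ (∑ i, v i ^ 2) / n * (kappaPlus X m * ∑ j, w j ^ 2) := by
          gcongr
          exact gramForm_le_kappaPlus_mul X hcard
      _ = kappaPlus X m * ((∑ i, v i ^ 2) / n) * ∑ j, w j ^ 2 := by ring

theorem card_mul_sq_le {X : Matrix (Fin n) (Fin p) ℝ} {m c : ℝ} {A : Finset (Fin p)}
    {v : Fin n → ℝ} (hc : 0 ≤ c) (hA : (A.card : ℝ) ≤ m) (h : ∀ j ∈ A, c ≤ |score X v j|) :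
    A.card * c ^ 2 ≤ kappaPlus X m * ((∑ i, v i ^ 2) / n) := by
  refine le_trans ?_ (sum_score_sq_le X hA v)
  rw [← nsmul_eq_mul]
  refine Finset.card_nsmul_le_sum A _ _ fun j hj => ?_
  rw [← sq_abs (score X v j)]
  exact pow_le_pow_left₀ hc (h j hj) 2

theorem card_lt_of_le_abs_score {X : Matrix (Fin n) (Fin p) ℝ} {k : ℕ} {c : ℝ}
    {J : Finset (Fin p)} {v : Fin n → ℝ} (hc : 0 ≤ c) (h : ∀ j ∈ J, c ≤ |score X v j|)
    (hlt : kappaPlus X k * ((∑ i, v i ^ 2) / n) < k * c ^ 2) : J.card < k := by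
  by_contra! hJ
  obtain ⟨A, hAJ, rfl⟩ := Finset.exists_subset_card_eq hJ
  exact hlt.not_ge (card_mul_sq_le hc le_rfl fun j hj => h j (hAJ hj))

/-! ### Sparsity of global minimizers -/

theorem score_residual (X : Matrix (Fin n) (Fin p) ℝ) (β u : Fin p → ℝ) (ε : Fin n → ℝ)
    (j : Fin p) :
    score X (X *ᵥ (β + u) - (X *ᵥ β + ε)) j = score X (X *ᵥ u) j - score X ε j := by
  rw [mulVec_add, add_sub_add_left_eq_sub, map_sub, Pi.sub_apply]

theorem abs_score_mulVec_le (hn : 0 < n) (hρ : IsPenalty ρ) {X : Matrix (Fin n) (Fin p) ℝ}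
    {j : Fin p} (hX : ∑ i, X i j ^ 2 = n) {β u : Fin p → ℝ} {ε : Fin n → ℝ}
    (hb : IsMinOn (loss X (X *ᵥ β + ε) ρ) Set.univ (β + u)) {η : ℝ} (hη : 0 < η)
    (hnull : NullConsistent X ε ρ η) :
    |score X (X *ᵥ u) j| ≤ (1 + η) * threshold ρ := by
  have hres := abs_score_le_threshold hn hρ hX hb
  rw [score_residual] at hres
  linarith [hnull.abs_score_le hn hρ hX hη,
    abs_sub_abs_le_abs_sub (score X (X *ᵥ u) j) (score X ε j)]

theorem nonempty_of_cone (hρ : IsPenalty ρ) {S : Finset (Fin p)} {u : Fin p → ℝ} {ξ : ℝ}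
    (hcone : ∑ j ∈ Sᶜ, ρ (u j) < ξ * ∑ j ∈ S, ρ (u j)) : S.Nonempty := by
  by_contra hS
  rw [Finset.not_nonempty_iff_eq_empty.1 hS, Finset.sum_empty, mul_zero] at hcone
  exact hcone.not_ge (Finset.sum_nonneg fun _ _ => hρ.nonneg _)

theorem mem_supp_sdiff {S : Finset (Fin p)} {u : Fin p → ℝ} {j : Fin p} :
    j ∈ supp u \ S ↔ u j ≠ 0 ∧ j ∉ S := by
  simp [supp]

theorem card_large_mul_le (hρ : IsPenalty ρ) {t₀ v : ℝ} (h : ∀ s, s ≠ 0 → t₀ ≤ |s| → v ≤ ρ s)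
    (u : Fin p → ℝ) (S : Finset (Fin p)) :
    {j ∈ supp u \ S | t₀ ≤ |u j|}.card * v ≤ ∑ j ∈ Sᶜ, ρ (u j) := by
  rw [← nsmul_eq_mul]
  refine (Finset.card_nsmul_le_sum _ (fun j => ρ (u j)) _ fun j hj => ?_).trans
    (Finset.sum_le_sum_of_subset_of_nonneg (fun j hj => ?_) fun _ _ _ => hρ.nonneg _)
  · obtain ⟨hj, hjt⟩ := Finset.mem_filter.1 hj
    exact h _ (mem_supp_sdiff.1 hj).1 hjt
  · exact Finset.mem_compl.2 (mem_supp_sdiff.1 (Finset.mem_filter.1 hj).1).2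

theorem le_abs_of_mem_pdot (hρ : IsPenalty ρ) {t₀ c : ℝ}
    (h : ∀ s ∈ Set.Ioo 0 t₀, ∀ d ∈ pdot ρ s, c ≤ d) {s d : ℝ} (hs : s ≠ 0) (hst : |s| < t₀)
    (hd : d ∈ pdot ρ s) : c ≤ |d| := by
  rcases hs.lt_or_gt with hneg | hpos
  · rw [abs_of_neg hneg] at hst
    exact (h (-s) ⟨neg_pos.2 hneg, hst⟩ (-d) (neg_mem_pdot hρ hd)).trans (neg_le_abs d)
  · rw [abs_of_pos hpos] at hst
    exact (h s ⟨hpos, hst⟩ d hd).trans (le_abs_self d)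

theorem le_abs_score_of_small (hn : 0 < n) (hρ : IsPenalty ρ) (hd : LRDifferentiable ρ)
    {X : Matrix (Fin n) (Fin p) ℝ} (hX : ∀ j, ∑ i, X i j ^ 2 = n) {β u : Fin p → ℝ}
    {ε : Fin n → ℝ} {S : Finset (Fin p)} (hβ : ∀ j ∉ S, β j = 0)
    (hb : IsMinOn (loss X (X *ᵥ β + ε) ρ) Set.univ (β + u)) {t₀ c a : ℝ}
    (h : ∀ s ∈ Set.Ioo 0 t₀, ∀ d ∈ pdot ρ s, c + a ≤ d) (hε : ∀ j, |score X ε j| ≤ a) {j : Fin p}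
    (hj : j ∈ {j ∈ supp u \ S | ¬ t₀ ≤ |u j|}) : c ≤ |score X (X *ᵥ u) j| := by
  obtain ⟨hjS, hjt⟩ := Finset.mem_filter.1 hj
  obtain ⟨hu, hjS⟩ := mem_supp_sdiff.1 hjS
  have hmem := neg_score_mem_pdot hn hρ hd (hX j) hb
  rw [score_residual, Pi.add_apply, hβ j hjS, zero_add] at hmem
  have hslope := le_abs_of_mem_pdot hρ h hu (not_le.1 hjt) hmem
  rw [abs_neg] at hslope
  linarith [abs_sub (score X (X *ᵥ u) j) (score X ε j), hε j]

theorem valueAt_le (hρ : IsPenalty ρ) {t₀ s : ℝ} (ht₀ : 0 ≤ t₀) (hs : s ≠ 0) (h : t₀ ≤ |s|) :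
    valueAt ρ t₀ ≤ ρ s := by
  rw [valueAt]
  split_ifs
  · rw [← hρ.map_abs s]
    exact csInf_le ⟨0, by rintro _ ⟨t, -, rfl⟩; exact hρ.nonneg t⟩ ⟨|s|, abs_pos.2 hs, rfl⟩
  · exact hρ.le_of_abs_le (by rwa [abs_of_nonneg ht₀])

theorem energy_le_DeltaS (hn : 0 < n) (hρ : IsPenalty ρ) (hd : LRDifferentiable ρ)
    {X : Matrix (Fin n) (Fin p) ℝ} (hX : ∀ j, ∑ i, X i j ^ 2 = n) {β u : Fin p → ℝ}
    {ε : Fin n → ℝ} {S : Finset (Fin p)} (hβ : ∀ j ∉ S, β j = 0)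
    (hb : IsMinOn (loss X (X *ᵥ β + ε) ρ) Set.univ (β + u)) (hu : u ≠ 0) {η : ℝ} (hη : 0 < η)
    (hη1 : η < 1) (hnull : NullConsistent X ε ρ η) {t : ℝ} (ht : 0 < ρ t)
    (hΔ : DeltaS X ρ S η ≠ ⊤) :
    gramForm X u / 2 + ∑ j ∈ Sᶜ, ρ (u j) ≤ xi η * (DeltaS X ρ S η).toReal := by
  have hle := hb (Set.mem_univ β)
  have hcone := cone_inequality_strict hρ ht hβ hle hη hη1 hnull hu
  have hl1 := sum_abs_le_of_cone hn hu (nonempty_of_cone hρ hcone) (by linarith)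
    (hρ.threshold_pos ht) hcone fun j => abs_score_mulVec_le hn hρ (hX j) hb hη hnull
  have hξ := one_lt_xi hη hη1
  calc gramForm X u / 2 + ∑ j ∈ Sᶜ, ρ (u j) ≤ xi η * ∑ j ∈ S, ρ (u j) :=
        cone_inequality hρ hβ hle hη hη1 hnull
    _ ≤ xi η * (DeltaS X ρ S η).toReal := by
        gcongr
        exact sum_le_toReal_Delta hρ hd hl1 hΔ

theorem card_small_lt_of_lt_iInf (hn : 0 < n) (hρ : IsPenalty ρ) (hd : LRDifferentiable ρ)
    {X : Matrix (Fin n) (Fin p) ℝ} (hX : ∀ j, ∑ i, X i j ^ 2 = n) {β u : Fin p → ℝ}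
    {ε : Fin n → ℝ} {S : Finset (Fin p)} (hβ : ∀ j ∉ S, β j = 0)
    (hb : IsMinOn (loss X (X *ᵥ β + ε) ρ) Set.univ (β + u)) {t₀ M : ℝ} {m₀ : ℕ} (hm₀ : 0 < m₀)
    (hM : gramForm X u / 2 ≤ M)
    (hlt : ((√(2 * kappaPlus X m₀ * M / m₀) + ‖fun j : Fin p => (Xᵀ *ᵥ ε) j / n‖ : ℝ) : EReal)
      < ⨅ s ∈ Set.Ioo 0 t₀, ⨅ d ∈ pdot ρ s, (d : EReal)) :
    {j ∈ supp u \ S | ¬ t₀ ≤ |u j|}.card < m₀ := by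
  obtain ⟨c, hc, hcinf⟩ := EReal.lt_iff_exists_real_btwn.1 hlt
  set a := ‖fun j : Fin p => (Xᵀ *ᵥ ε) j / n‖
  have hnoise (j : Fin p) : |score X ε j| ≤ a := by
    rw [score_apply]
    exact norm_le_pi_norm (fun j : Fin p => (Xᵀ *ᵥ ε) j / n) j
  have hslope : ∀ s ∈ Set.Ioo 0 t₀, ∀ d ∈ pdot ρ s, c - a + a ≤ d := fun s hs d hds => by
    rw [sub_add_cancel]
    exact EReal.coe_le_coe_iff.1 (hcinf.le.trans ((iInf₂_le s hs).trans (iInf₂_le d hds)))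
  have hsqrt : √(2 * kappaPlus X m₀ * M / m₀) < c - a :=
    lt_sub_iff_add_lt.2 (EReal.coe_lt_coe_iff.1 hc)
  have hca : 0 < c - a := (Real.sqrt_nonneg _).trans_lt hsqrt
  have hsq := (Real.sqrt_lt' hca).1 hsqrt
  rw [div_lt_iff₀' (Nat.cast_pos.2 hm₀)] at hsq
  have hκ := kappaPlus_nonneg X m₀
  have henergy : kappaPlus X m₀ * gramForm X u < m₀ * (c - a) ^ 2 :=
    calc kappaPlus X m₀ * gramForm X u ≤ kappaPlus X m₀ * (2 * M) := by gcongr; linarith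
      _ < m₀ * (c - a) ^ 2 := by linarith
  exact card_lt_of_le_abs_score hca.le
    (fun j hj => le_abs_score_of_small hn hρ hd hX hβ hb hslope hnoise hj) henergy

theorem IsSparsityBound.card_supp_sdiff_le (hn : 0 < n) (hρ : IsPenalty ρ)
    (hd : LRDifferentiable ρ) {X : Matrix (Fin n) (Fin p) ℝ} (hX : ∀ j, ∑ i, X i j ^ 2 = n)
    {β u : Fin p → ℝ} {ε : Fin n → ℝ} {S : Finset (Fin p)} (hβ : ∀ j ∉ S, β j = 0)
    (hb : IsMinOn (loss X (X *ᵥ β + ε) ρ) Set.univ (β + u)) (hu : u ≠ 0) {η m : ℝ}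
    (hη : 0 < η) (hη1 : η < 1) (hnull : NullConsistent X ε ρ η)
    (hm : IsSparsityBound X ε ρ S η m) : ((supp u \ S).card : ℝ) ≤ m := by
  obtain ⟨t₀, m₀, hΔ, hval, hcase, rfl⟩ := hm
  have ht₀ : 0 ≤ t₀ := by rcases hcase with h | h; exacts [h.1.ge, h.1.le]
  have hpos : 0 < ρ (t₀ + 1) :=
    hval.trans_le (valueAt_le hρ ht₀ (by positivity) (le_abs.2 (Or.inl (by linarith))))
  have henergy := energy_le_DeltaS hn hρ hd hX hβ hb hu hη hη1 hnull hpos hΔ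
  set M := (DeltaS X ρ S η).toReal
  have hlarge : {j ∈ supp u \ S | t₀ ≤ |u j|}.card ≤ ⌊xi η * M / valueAt ρ t₀⌋₊ := by
    refine Nat.le_floor ((le_div_iff₀ hval).2 ?_)
    linarith [gramForm_nonneg X u, card_large_mul_le hρ (fun _ => valueAt_le hρ ht₀) u S]
  have hsmall : {j ∈ supp u \ S | ¬ t₀ ≤ |u j|}.card ≤ m₀ := by
    rcases hcase with ⟨rfl, rfl⟩ | ⟨-, hm₀, hlt⟩
    · simp
    · rw [show 2 * xi η * kappaPlus X m₀ * M = 2 * kappaPlus X m₀ * (xi η * M) by ring] at hlt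
      refine (card_small_lt_of_lt_iInf hn hρ hd hX hβ hb hm₀ ?_ hlt).le
      linarith [Finset.sum_nonneg fun j (_ : j ∈ Sᶜ) => hρ.nonneg (u j)]
  rw [← Finset.card_filter_add_card_filter_not (fun j => t₀ ≤ |u j|), Nat.cast_add, add_comm]
  gcongr

theorem add_le_max_mul {x z a b k : ℝ} (ha : 0 < a) (hb : 0 < b) (hx : 0 ≤ x) (hz : 0 ≤ z)
    (h : x / a + z / b ≤ k) : x + z ≤ max a b * k :=
  calc x + z = a * (x / a) + b * (z / b) := by field_simp
    _ ≤ max a b * (x / a) + max a b * (z / b) := by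
        gcongr
        exacts [le_max_left a b, le_max_right a b]
    _ = max a b * (x / a + z / b) := (mul_add _ _ _).symm
    _ ≤ max a b * k := by gcongr

theorem energy_le_of_forall_le (hρ : IsPenalty ρ) {X : Matrix (Fin n) (Fin p) ℝ}
    {β u : Fin p → ℝ} {ε : Fin n → ℝ} {S : Finset (Fin p)} (hβ : ∀ j ∉ S, β j = 0)
    (hle : loss X (X *ᵥ β + ε) ρ (β + u) ≤ loss X (X *ᵥ β + ε) ρ β) {η : ℝ} (hη : 0 < η)
    (hη1 : η < 1) (hnull : NullConsistent X ε ρ η) {M : ℝ} (hM : ∀ t, ρ t ≤ M) :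
    gramForm X u / 2 + ∑ j ∈ Sᶜ, ρ (u j) ≤ xi η * (S.card * M) := by
  have hξ := one_lt_xi hη hη1
  refine (cone_inequality hρ hβ hle hη hη1 hnull).trans ?_
  gcongr
  rw [← nsmul_eq_mul]
  exact Finset.sum_le_card_nsmul _ _ _ fun j _ => hM _

theorem le_of_mem_pdot_of_concaveOn (hc : ConcaveOn ℝ (Set.Ioi 0) ρ) {s t d e : ℝ} (hs : 0 < s)
    (hst : s < t) (he : e ∈ pdot ρ t) (hd : d ∈ pdot ρ s) : e ≤ d :=
  (le_slope_of_mem_pdot hc hs hst he).trans (slope_le_of_mem_pdot hc hs hst hd)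

/- The energy `gramForm X u / 2` and the penalty of the large coordinates share the budget
`ξ |S| M`, so the two normalized counts add up to at most `|S|`. -/
theorem card_supp_sdiff_le_max_mul (hn : 0 < n) (hρ : IsPenalty ρ) (hd : LRDifferentiable ρ)
    {X : Matrix (Fin n) (Fin p) ℝ} (hX : ∀ j, ∑ i, X i j ^ 2 = n) {β u : Fin p → ℝ}
    {ε : Fin n → ℝ} {S : Finset (Fin p)} (hβ : ∀ j ∉ S, β j = 0)
    (hb : IsMinOn (loss X (X *ᵥ β + ε) ρ) Set.univ (β + u)) {t₀ a c v B α : ℝ}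
    (hlarge : ∀ s, s ≠ 0 → t₀ ≤ |s| → v ≤ ρ s) (hv : 0 < v)
    (hsmall : ∀ s ∈ Set.Ioo 0 t₀, ∀ d ∈ pdot ρ s, c + a ≤ d) (hc : 0 < c)
    (hε : ∀ j, |score X ε j| ≤ a) (hα : 0 < α) (hB : 0 < B) {m₀ : ℕ}
    (hm₀ : (m₀ : ℝ) = α * S.card) (hS : S.Nonempty)
    (henergy : gramForm X u / 2 + ∑ j ∈ Sᶜ, ρ (u j) ≤ B * S.card)
    (hκ : 2 * B * kappaPlus X m₀ < α * c ^ 2) :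
    ((supp u \ S).card : ℝ) ≤ max (B / v) α * S.card := by
  have hpen : 0 ≤ ∑ j ∈ Sᶜ, ρ (u j) := Finset.sum_nonneg fun _ _ => hρ.nonneg _
  have hS' : (0 : ℝ) < S.card := Nat.cast_pos.2 hS.card_pos
  have hκ0 := kappaPlus_nonneg X m₀
  have hscore : ∀ j ∈ {j ∈ supp u \ S | ¬ t₀ ≤ |u j|}, c ≤ |score X (X *ᵥ u) j| := fun _ =>
    le_abs_score_of_small hn hρ hd hX hβ hb hsmall hε
  have hcard : {j ∈ supp u \ S | ¬ t₀ ≤ |u j|}.card ≤ m₀ := by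
    refine (card_lt_of_le_abs_score hc.le hscore ?_).le
    calc kappaPlus X m₀ * gramForm X u ≤ kappaPlus X m₀ * (2 * (B * S.card)) := by
          gcongr
          linarith
      _ = 2 * B * kappaPlus X m₀ * S.card := by ring
      _ < α * c ^ 2 * S.card := by gcongr
      _ = m₀ * c ^ 2 := by rw [hm₀]; ring
  have hcount := card_mul_sq_le hc.le (Nat.cast_le.2 hcard) hscore
  have hcount' : {j ∈ supp u \ S | ¬ t₀ ≤ |u j|}.card / α ≤ gramForm X u / 2 / B := by
    rw [div_le_div_iff₀ hα hB]
    refine le_of_mul_le_mul_right (a := 2 * c ^ 2) ?_ (by positivity)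
    calc _ = 2 * B * ({j ∈ supp u \ S | ¬ t₀ ≤ |u j|}.card * c ^ 2) := by ring
      _ ≤ 2 * B * (kappaPlus X m₀ * gramForm X u) :=
          mul_le_mul_of_nonneg_left hcount (by positivity)
      _ = 2 * B * kappaPlus X m₀ * gramForm X u := by ring
      _ ≤ α * c ^ 2 * gramForm X u := by gcongr; exact gramForm_nonneg X u
      _ = _ := by ring
  have hpos' : {j ∈ supp u \ S | t₀ ≤ |u j|}.card / (B / v) ≤ (∑ j ∈ Sᶜ, ρ (u j)) / B := by
    rw [div_div_eq_mul_div]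
    gcongr
    exact card_large_mul_le hρ hlarge u S
  rw [← Finset.card_filter_add_card_filter_not (fun j => t₀ ≤ |u j|), Nat.cast_add]
  refine add_le_max_mul (by positivity) hα (by positivity) (by positivity) ?_
  refine (add_le_add hpos' hcount').trans ?_
  rw [← add_div, div_le_iff₀' hB]
  linarith

theorem two_mul_xi_mul_lt {η γ k α c l : ℝ} (hη : 0 < η) (hη1 : η < 1) (hα : 0 < α) (hl : 0 < l)
    (h : 2 * γ * k / α < c ^ 2 * (1 - η) / (1 + η)) :
    2 * (xi η * γ * l ^ 2) * k < α * (c * l) ^ 2 := by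
  have hξ := one_lt_xi hη hη1
  have hinv : (1 - η) / (1 + η) = (xi η)⁻¹ := (inv_div _ _).symm
  rw [mul_div_assoc (c ^ 2), hinv, ← div_eq_mul_inv, div_lt_div_iff₀ hα (by linarith)] at h
  have := mul_lt_mul_of_pos_right h (by positivity : 0 < l ^ 2)
  linarith

theorem IsSparsityBoundBounded.card_supp_sdiff_le (hn : 0 < n) (hρ : IsPenalty ρ)
    (hd : LRDifferentiable ρ) {X : Matrix (Fin n) (Fin p) ℝ} (hX : ∀ j, ∑ i, X i j ^ 2 = n)
    {β u : Fin p → ℝ} {ε : Fin n → ℝ} {S : Finset (Fin p)} (hβ : ∀ j ∉ S, β j = 0)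
    (hb : IsMinOn (loss X (X *ᵥ β + ε) ρ) Set.univ (β + u)) (hu : u ≠ 0) {η m lam : ℝ}
    (hlam : 0 < lam) (hη : 0 < η) (hη1 : η < 1) (hnull : NullConsistent X ε ρ η)
    (hm : IsSparsityBoundBounded X ρ lam S η m) : ((supp u \ S).card : ℝ) ≤ m := by
  obtain ⟨γs, a₀, a₁, γ, α, g, m₀, rfl, hconc, hbdd, hγs, ha₀, -, -, hηc, ⟨d₀, hd₀, hd₀c⟩,
    hα, hm₀, hκ, hg, hm⟩ := hm
  set c := 1 - a₁ / γ
  have hc : 0 < c := hη.trans hηc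
  have hξ := one_lt_xi hη hη1
  obtain ⟨s, hs⟩ := IsPenalty.exists_pos_of_threshold_pos hρ hlam
  set lam := threshold ρ
  have hle := hb (Set.mem_univ β)
  have hS := nonempty_of_cone hρ (cone_inequality_strict hρ hs hβ hle hη hη1 hnull hu)
  have hsup (t : ℝ) : ρ t ≤ γs * lam ^ 2 := by
    rw [hγs, div_mul_cancel₀ _ (by positivity)]
    exact le_csSup hbdd ⟨t, rfl⟩
  have hγs0 : 0 < γs := pos_of_mul_pos_left (hs.trans_le (hsup s)) (by positivity)
  have hg0 : 0 < g := by rw [hg]; positivity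
  have hlarge : ∀ t, t ≠ 0 → a₀ * lam ≤ |t| → a₀ * c * lam ^ 2 ≤ ρ t := fun t _ ht =>
    calc a₀ * c * lam ^ 2 = lam * c * (a₀ * lam) := by ring
      _ ≤ d₀ * (a₀ * lam) := by gcongr
      _ ≤ ρ (a₀ * lam) := mul_le_of_mem_pdot hρ hconc (by positivity) hd₀
      _ ≤ ρ t := hρ.le_of_abs_le (by rwa [abs_of_pos (by positivity)])
  have hsmall : ∀ t ∈ Set.Ioo 0 (a₀ * lam), ∀ d ∈ pdot ρ t, (c - η) * lam + η * lam ≤ d :=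
    fun t ht d hdt => by
      linarith [le_of_mem_pdot_of_concaveOn hconc ht.1 ht.2 hd₀ hdt]
  have henergy := energy_le_of_forall_le hρ hβ hle hη hη1 hnull hsup
  have hcount := card_supp_sdiff_le_max_mul hn hρ hd hX hβ hb hlarge (by positivity) hsmall
    (mul_pos (sub_pos.2 hηc) hlam) (fun j => hnull.abs_score_le hn hρ (hX j) hη) hα
    (by positivity : 0 < xi η * γs * lam ^ 2) hm₀ hS (by linarith)
    (two_mul_xi_mul_lt hη hη1 hα hlam hκ)
  have hratio : xi η * γs * lam ^ 2 / (a₀ * c * lam ^ 2) = xi η * g := by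
    rw [hg]
    field_simp
  rw [hratio] at hcount
  refine hcount.trans ?_
  rcases hm with ⟨hgα, rfl⟩ | rfl <;> gcongr <;> refine max_le ?_ ?_
  · linarith
  · linarith
  · linarith
  · linarith [mul_pos (one_pos.trans hξ) hg0]

theorem IsSparsityBound.nonneg {X : Matrix (Fin n) (Fin p) ℝ} {ε : Fin n → ℝ}
    {S : Finset (Fin p)} {η m : ℝ} (h : IsSparsityBound X ε ρ S η m) : 0 ≤ m := by
  obtain ⟨t₀, m₀, -, -, -, rfl⟩ := h
  positivity

theorem IsSparsityBoundBounded.nonneg (hρ : IsPenalty ρ) {X : Matrix (Fin n) (Fin p) ℝ}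
    {S : Finset (Fin p)} {η m lam : ℝ} (hη : 0 < η) (hη1 : η < 1)
    (h : IsSparsityBoundBounded X ρ lam S η m) : 0 ≤ m := by
  obtain ⟨γs, a₀, a₁, γ, α, g, m₀, -, -, -, hγs, ha₀, -, -, hc, -, hα, -, -, hg, hm⟩ := h
  have hξ := one_lt_xi hη hη1
  have hsup : 0 ≤ sSup (Set.range ρ) := Real.sSup_nonneg (Set.forall_mem_range.2 hρ.nonneg)
  have hγs0 : 0 ≤ γs := by rw [hγs]; positivity
  have hg0 : 0 ≤ g := by
    rw [hg]
    exact div_nonneg (by positivity) (hη.trans hc).le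
  rcases hm with ⟨-, rfl⟩ | rfl <;> positivity

/-! ### Local solutions that are global -/

theorem neg_mul_le_of_nonconvexity_eq_zero {κ t d s e : ℝ} (h : nonconvexity ρ κ t d = 0)
    (he : e ∈ pdot ρ s) : -((e - d) * (s - t)) ≤ κ * (s - t) ^ 2 := by
  have hle : ((-Real.sign (s - t) * (e - d) - κ * |s - t| : ℝ) : EReal) ≤ nonconvexity ρ κ t d :=
    le_iSup_of_le s (le_iSup₂_of_le e he le_rfl)
  rw [h, ← EReal.coe_zero, EReal.coe_le_coe_iff] at hle
  calc -((e - d) * (s - t)) = -Real.sign (s - t) * (e - d) * |s - t| := by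
        rcases lt_trichotomy (s - t) 0 with h | h | h
        · rw [Real.sign_of_neg h, abs_of_neg h]; ring
        · simp [h]
        · rw [Real.sign_of_pos h, abs_of_pos h]; ring
    _ ≤ κ * |s - t| * |s - t| :=
        mul_le_mul_of_nonneg_right (sub_nonpos.1 hle) (abs_nonneg _)
    _ = κ * (s - t) ^ 2 := by rw [mul_assoc, ← sq, sq_abs]

theorem IsApproxLocalWith.score_eq_neg {X : Matrix (Fin n) (Fin p) ℝ} {y : Fin n → ℝ}
    {b d : Fin p → ℝ} (h : IsApproxLocalWith X y ρ 0 b d) (j : Fin p) :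
    score X (X *ᵥ b - y) j = -d j := by
  have hsum := h.2.antisymm (Finset.sum_nonneg fun _ _ => sq_nonneg _)
  rw [Finset.sum_eq_zero_iff_of_nonneg fun _ _ => sq_nonneg _] at hsum
  rw [score_apply]
  exact eq_neg_of_add_eq_zero_left (sq_eq_zero_iff.1 (hsum j (Finset.mem_univ j)))

theorem card_supp_sub_sdiff_le (hn : 0 < n) (hρ : IsPenalty ρ) (hd : LRDifferentiable ρ)
    {X : Matrix (Fin n) (Fin p) ℝ} (hX : ∀ j, ∑ i, X i j ^ 2 = n) {β b : Fin p → ℝ}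
    {ε : Fin n → ℝ} {S : Finset (Fin p)} (hβ : ∀ j ∉ S, β j = 0)
    (hb : IsMinOn (loss X (X *ᵥ β + ε) ρ) Set.univ b) {η m lam : ℝ} (hlam : 0 < lam)
    (hη : 0 < η) (hη1 : η < 1) (hnull : NullConsistent X ε ρ η)
    (hm : IsSparsityBound X ε ρ S η m ∨ IsSparsityBoundBounded X ρ lam S η m) :
    ((supp (b - β) \ S).card : ℝ) ≤ m := by
  rcases eq_or_ne (b - β) 0 with hu | hu
  · have hm0 : 0 ≤ m := hm.elim (·.nonneg) (·.nonneg hρ hη hη1)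
    rw [hu]
    simpa [supp] using hm0
  · rw [← add_sub_cancel β b] at hb
    exact hm.elim (·.card_supp_sdiff_le hn hρ hd hX hβ hb hu hη hη1 hnull)
      (·.card_supp_sdiff_le hn hρ hd hX hβ hb hu hlam hη hη1 hnull)

theorem gramForm_sub_le (hn : 0 < n) (hρ : IsPenalty ρ) (hd : LRDifferentiable ρ)
    {X : Matrix (Fin n) (Fin p) ℝ} (hX : ∀ j, ∑ i, X i j ^ 2 = n) {y : Fin n → ℝ}
    {b b' d : Fin p → ℝ} {κ : ℝ} (hb : IsApproxLocalWith X y ρ 0 b d)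
    (hθ : ∀ j, nonconvexity ρ κ (b j) (d j) = 0) (hb' : IsMinOn (loss X y ρ) Set.univ b') :
    gramForm X (b' - b) ≤ κ * ∑ j, (b' - b) j ^ 2 := by
  have hscore (j : Fin p) : score X (X *ᵥ (b' - b)) j
      = -(-score X (X *ᵥ b' - y) j - d j) := by
    rw [mulVec_sub, ← sub_sub_sub_cancel_right _ _ y, map_sub, Pi.sub_apply, hb.score_eq_neg]
    ring
  calc gramForm X (b' - b) = ∑ j, score X (X *ᵥ (b' - b)) j * (b' - b) j := by
        simp only [sum_score_mul, gramForm, sq]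
    _ ≤ ∑ j, κ * (b' - b) j ^ 2 := Finset.sum_le_sum fun j _ => by
        rw [hscore, neg_mul]
        exact neg_mul_le_of_nonconvexity_eq_zero (hθ j)
          (neg_score_mem_pdot hn hρ hd (hX j) hb')
    _ = κ * ∑ j, (b' - b) j ^ 2 := (Finset.mul_sum _ _ _).symm

theorem isGlobalSolution_of_isApproxLocalWith (hn : 0 < n) (hρ : IsPenalty ρ)
    (hd : LRDifferentiable ρ) {X : Matrix (Fin n) (Fin p) ℝ} (hX : ∀ j, ∑ i, X i j ^ 2 = n)
    {β b d : Fin p → ℝ} {ε : Fin n → ℝ} {S : Finset (Fin p)} (hβ : ∀ j ∉ S, β j = 0)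
    {η m κ lam : ℝ} (hlam : 0 < lam) (hη : 0 < η) (hη1 : η < 1) (hnull : NullConsistent X ε ρ η)
    (hm : IsSparsityBound X ε ρ S η m ∨ IsSparsityBoundBounded X ρ lam S η m) (hκ : 0 ≤ κ)
    (hκm : ENNReal.ofReal κ < kappaMinus X (m + S.card))
    (hb : IsApproxLocalWith X (X *ᵥ β + ε) ρ 0 b d) (hbS : ∀ j ∉ S, b j = 0)
    (hθ : ∀ j, nonconvexity ρ κ (b j) (d j) = 0) : IsGlobalSolution X (X *ᵥ β + ε) ρ b := by
  have huniq : ∀ b', IsMinOn (loss X (X *ᵥ β + ε) ρ) Set.univ b' → b' = b := fun b' hb' => by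
    by_contra hne
    have hsub : supp (b' - b) ⊆ (supp (b' - β) \ S) ∪ S := fun j hj => by
      by_cases hjS : j ∈ S
      · exact Finset.mem_union_right _ hjS
      · simpa [supp, hbS j hjS, hβ j hjS, hjS] using hj
    have hcard : ((supp (b' - b)).card : ℝ) ≤ m + S.card :=
      calc ((supp (b' - b)).card : ℝ) ≤ (supp (b' - β) \ S).card + S.card := mod_cast
            (Finset.card_le_card hsub).trans (Finset.card_union_le _ _)
        _ ≤ m + S.card := by
            gcongr
            exact card_supp_sub_sdiff_le hn hρ hd hX hβ hb' hlam hη hη1 hnull hm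
    exact (mul_lt_gramForm_of_lt_kappaMinus hκ hκm hcard (sub_ne_zero.2 hne)).not_ge
      (gramForm_sub_le hn hρ hd hX hb hθ hb')
  obtain ⟨b₀, hb₀⟩ := exists_isMinOn_loss hρ hd X (X *ᵥ β + ε)
  exact ⟨huniq b₀ hb₀ ▸ hb₀, huniq⟩

/-! ### The oracle estimator -/

theorem mulVec_eq_cols_mulVec (X : Matrix (Fin n) (Fin p) ℝ) {S : Finset (Fin p)}
    {b : Fin p → ℝ} (hb : ∀ j ∉ S, b j = 0) :
    X *ᵥ b = cols X S *ᵥ fun j => b j := by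
  ext i
  refine Eq.trans ?_ (Finset.sum_coe_sort S fun j => X i j * b j).symm
  exact (Finset.sum_subset (Finset.subset_univ S) fun j _ hj => by rw [hb j hj, mul_zero]).symm

theorem gram_mulVec (X : Matrix (Fin n) (Fin p) ℝ) (S : Finset (Fin p))
    (v : {j // j ∈ S} → ℝ) : gram X S *ᵥ v = (cols X S)ᵀ *ᵥ (cols X S *ᵥ v) := by
  rw [gram, mulVec_mulVec]

theorem cols_mulVec_mem_colSpace (X : Matrix (Fin n) (Fin p) ℝ) (S : Finset (Fin p))
    (v : {j // j ∈ S} → ℝ) : WithLp.toLp 2 (cols X S *ᵥ v) ∈ colSpace X S := by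
  have hsum : WithLp.toLp 2 (cols X S *ᵥ v) = ∑ j, v j • WithLp.toLp 2 fun i => X i j := by
    ext i
    simp [mulVec, dotProduct, cols, mul_comm]
  rw [hsum]
  exact Submodule.sum_mem _ fun j _ =>
    Submodule.smul_mem _ _ (Submodule.subset_span ⟨j, j.2, rfl⟩)

theorem toLp_mem_orthogonal_colSpace_iff {X : Matrix (Fin n) (Fin p) ℝ} {S : Finset (Fin p)}
    {w : Fin n → ℝ} : WithLp.toLp 2 w ∈ (colSpace X S)ᗮ ↔ ∀ j ∈ S, (Xᵀ *ᵥ w) j = 0 := by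
  have hinner (j : Fin p) :
      inner ℝ (WithLp.toLp 2 fun i => X i j) (WithLp.toLp 2 w) = (Xᵀ *ᵥ w) j := by
    simp [mulVec, dotProduct, PiLp.inner_apply, mul_comm]
  rw [← Submodule.span_singleton_le_iff_mem, Submodule.le_orthogonal_iff_le_orthogonal, colSpace,
    Submodule.span_le, Set.image_subset_iff]
  simp only [Set.subset_def, Set.mem_preimage, SetLike.mem_coe,
    Submodule.mem_orthogonal_singleton_iff_inner_left, hinner]

theorem score_projPerp (X : Matrix (Fin n) (Fin p) ℝ) {S : Finset (Fin p)} (ε : Fin n → ℝ)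
    {j : Fin p} (hj : j ∈ S) : score X (projPerp X S ε) j = 0 := by
  have hperp : WithLp.toLp 2 (projPerp X S ε) ∈ (colSpace X S)ᗮ :=
    Submodule.starProjection_apply_mem _ _
  rw [score_apply, toLp_mem_orthogonal_colSpace_iff.1 hperp j hj, zero_div]

theorem oracle_of_notMem (X : Matrix (Fin n) (Fin p) ℝ) (y : Fin n → ℝ) {S : Finset (Fin p)}
    {j : Fin p} (hj : j ∉ S) : oracle X y S j = 0 :=
  dif_neg hj

theorem transpose_mulVec_sub_oracle {X : Matrix (Fin n) (Fin p) ℝ} (y : Fin n → ℝ)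
    {S : Finset (Fin p)} (hgram : IsUnit (gram X S).det) {j : Fin p} (hj : j ∈ S) :
    (Xᵀ *ᵥ (y - X *ᵥ oracle X y S)) j = 0 := by
  have hcoe : (fun j : {j // j ∈ S} => oracle X y S j)
      = (gram X S)⁻¹ *ᵥ ((cols X S)ᵀ *ᵥ y) := funext fun j => dif_pos j.2
  have hnormal : (cols X S)ᵀ *ᵥ (X *ᵥ oracle X y S) = (cols X S)ᵀ *ᵥ y := by
    rw [mulVec_eq_cols_mulVec X fun j => oracle_of_notMem X y, ← gram_mulVec, hcoe, mulVec_mulVec,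
      mul_nonsing_inv _ hgram, one_mulVec]
  rw [mulVec_sub, Pi.sub_apply, sub_eq_zero]
  exact (congrFun hnormal ⟨j, hj⟩).symm

theorem sub_mulVec_oracle {X : Matrix (Fin n) (Fin p) ℝ} {β : Fin p → ℝ} (ε : Fin n → ℝ)
    {S : Finset (Fin p)} (hβ : ∀ j ∉ S, β j = 0) (hgram : IsUnit (gram X S).det) :
    X *ᵥ β + ε - X *ᵥ oracle X (X *ᵥ β + ε) S = projPerp X S ε := by
  set b := oracle X (X *ᵥ β + ε) S
  have hperp : WithLp.toLp 2 (X *ᵥ β + ε - X *ᵥ b) ∈ (colSpace X S)ᗮ :=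
    toLp_mem_orthogonal_colSpace_iff.2 fun j => transpose_mulVec_sub_oracle _ hgram
  have hcol : WithLp.toLp 2 ε - WithLp.toLp 2 (X *ᵥ β + ε - X *ᵥ b) ∈ (colSpace X S)ᗮᗮ := by
    have hfit : ε - (X *ᵥ β + ε - X *ᵥ b) = X *ᵥ (b - β) := by
      rw [mulVec_sub]
      abel
    rw [← WithLp.toLp_sub, hfit, mulVec_eq_cols_mulVec X fun j hj => by
      rw [Pi.sub_apply, hβ j hj, sub_zero]; exact oracle_of_notMem X _ hj]
    exact Submodule.le_orthogonal_orthogonal _ (cols_mulVec_mem_colSpace X S _)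
  ext i
  rw [projPerp, Submodule.eq_starProjection_of_mem_orthogonal hperp hcol]

theorem score_oracle_add {X : Matrix (Fin n) (Fin p) ℝ} {β : Fin p → ℝ} (ε : Fin n → ℝ)
    {S : Finset (Fin p)} (hβ : ∀ j ∉ S, β j = 0) (hgram : IsUnit (gram X S).det) (w : Fin p → ℝ)
    (j : Fin p) :
    score X (X *ᵥ (oracle X (X *ᵥ β + ε) S + w) - (X *ᵥ β + ε)) j
      = score X (X *ᵥ w) j - score X (projPerp X S ε) j := by
  have hres : X *ᵥ (oracle X (X *ᵥ β + ε) S + w) - (X *ᵥ β + ε) = X *ᵥ w - projPerp X S ε := by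
    rw [← sub_mulVec_oracle ε hβ hgram, mulVec_add]
    abel
  rw [hres, map_sub, Pi.sub_apply]

theorem isApproxLocal_oracle (hρ : IsPenalty ρ) {D : EReal} (hD : HasRightSlope ρ 0 D)
    {X : Matrix (Fin n) (Fin p) ℝ} {β : Fin p → ℝ} {ε : Fin n → ℝ} {S : Finset (Fin p)}
    (hβ : ∀ j ∉ S, β j = 0) (hgram : IsUnit (gram X S).det)
    (hnoise : ∀ j ∉ S, ((|score X (projPerp X S ε) j| : ℝ) : EReal) ≤ D) {d : Fin p → ℝ}
    (hd : ∀ j ∈ S, d j ∈ pdot ρ (oracle X (X *ᵥ β + ε) S j)) :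
    IsApproxLocal X (X *ᵥ β + ε) ρ (∑ j ∈ S, d j ^ 2) (oracle X (X *ᵥ β + ε) S) := by
  set b := oracle X (X *ᵥ β + ε) S
  have hscore (j : Fin p) :
      score X (X *ᵥ b - (X *ᵥ β + ε)) j = -score X (projPerp X S ε) j := by
    simpa using score_oracle_add ε hβ hgram 0 j
  refine ⟨fun j => if j ∈ S then d j else score X (projPerp X S ε) j, fun j => ?_, ?_⟩
  · by_cases hj : j ∈ S
    · simpa [hj] using hd j hj
    · simpa only [if_neg hj, b, oracle_of_notMem X _ hj] using mem_pdot_zero hρ hD (hnoise j hj)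
  · simp only [← score_apply, hscore]
    rw [← Finset.univ_inter S, ← Finset.sum_ite_mem]
    refine Finset.sum_le_sum fun j _ => ?_
    by_cases hj : j ∈ S
    · simp [hj, score_projPerp]
    · simp [hj]

/-! ### Zeros of gradient maps on a box -/

section BoxZero

variable {ι : Type*} [Fintype ι]

theorem lineDeriv_nonneg_of_isMinOn {E : Type*} [AddCommGroup E] [Module ℝ E] {f : E → ℝ}
    {s : Set E} {x y : E} {f' : ℝ} (hs : Convex ℝ s) (hx : x ∈ s) (hy : y ∈ s)
    (hmin : IsMinOn f s x) (hf : HasLineDerivAt ℝ f f' x (y - x)) : 0 ≤ f' := by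
  have hmin' : IsMinOn (fun t : ℝ => f (x + t • (y - x))) (Set.Icc 0 1) 0 := fun t ht => by
    simpa using hmin (hs.add_smul_sub_mem hx hy ht)
  have htangent : (1 : ℝ) ∈ posTangentConeAt (Set.Icc 0 1) (0 : ℝ) :=
    mem_posTangentConeAt_of_segment_subset (by rw [zero_add, segment_eq_Icc zero_le_one])
  simpa using hmin'.localize.hasFDerivWithinAt_nonneg
    (HasDerivAt.hasFDerivAt hf).hasFDerivWithinAt htangent

/-- The potential `vᵀ G v / 2 + ∑ⱼ ∫₀^{vⱼ} rⱼ` whose gradient, for symmetric `G`, is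
`G v + r(v)` with `r` acting coordinatewise. -/
def boxPotential (G : Matrix ι ι ℝ) (r : ι → ℝ → ℝ) (v : ι → ℝ) : ℝ :=
  v ⬝ᵥ G *ᵥ v / 2 + ∑ j, ∫ x in (0 : ℝ)..v j, r j x

theorem hasDerivAt_integral_of_continuous {f : ℝ → ℝ} (hf : Continuous f) (a : ℝ) :
    HasDerivAt (fun a => ∫ x in (0 : ℝ)..a, f x) (f a) a :=
  intervalIntegral.integral_hasDerivAt_right (hf.intervalIntegrable _ _)
    (hf.stronglyMeasurableAtFilter _ _) hf.continuousAt

theorem continuous_boxPotential (G : Matrix ι ι ℝ) {r : ι → ℝ → ℝ}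
    (hr : ∀ j, Continuous (r j)) : Continuous (boxPotential G r) := by
  have hquad : Continuous fun v : ι → ℝ => v ⬝ᵥ G *ᵥ v := by fun_prop
  have hint (j : ι) : Continuous fun a => ∫ x in (0 : ℝ)..a, r j x :=
    intervalIntegral.continuous_primitive (fun _ _ => (hr j).intervalIntegrable _ _) 0
  exact (hquad.div_const 2).add
    (continuous_finsetSum _ fun j _ => (hint j).comp (continuous_apply j))

theorem hasLineDerivAt_boxPotential {G : Matrix ι ι ℝ} (hG : Gᵀ = G) {r : ι → ℝ → ℝ}
    (hr : ∀ j, Continuous (r j)) (v d : ι → ℝ) :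
    HasLineDerivAt ℝ (boxPotential G r) (d ⬝ᵥ (G *ᵥ v + fun j => r j (v j))) v d := by
  have hquad (t : ℝ) : (v + t • d) ⬝ᵥ G *ᵥ (v + t • d)
      = v ⬝ᵥ G *ᵥ v + 2 * t * (d ⬝ᵥ G *ᵥ v) + t ^ 2 * (d ⬝ᵥ G *ᵥ d) := by
    have hcomm : v ⬝ᵥ G *ᵥ d = d ⬝ᵥ G *ᵥ v := by
      rw [dotProduct_mulVec, ← mulVec_transpose, hG, dotProduct_comm]
    simp only [mulVec_add, mulVec_smul, dotProduct_add, add_dotProduct, dotProduct_smul,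
      smul_dotProduct, hcomm, smul_eq_mul]
    ring
  have hint (j : ι) : HasDerivAt (fun t : ℝ => ∫ x in (0 : ℝ)..v j + t * d j, r j x)
      (r j (v j) * d j) 0 := by
    have hline : HasDerivAt (fun t : ℝ => v j + t * d j) (d j) 0 := by
      simpa using ((hasDerivAt_id (0 : ℝ)).mul_const (d j)).const_add (v j)
    exact HasDerivAt.comp (0 : ℝ)
      (by simpa using hasDerivAt_integral_of_continuous (hr j) (v j + 0 * d j)) hline
  have hpoly : HasDerivAt (fun t : ℝ => (v + t • d) ⬝ᵥ G *ᵥ (v + t • d) / 2) (d ⬝ᵥ G *ᵥ v) 0 := by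
    simp only [hquad]
    have hid := hasDerivAt_id (0 : ℝ)
    refine ((((hid.const_mul 2).mul_const (d ⬝ᵥ G *ᵥ v)).const_add (v ⬝ᵥ G *ᵥ v)).add
      ((hid.pow 2).mul_const (d ⬝ᵥ G *ᵥ d))).div_const 2 |>.congr_deriv ?_
    simp
  refine (hpoly.add (HasDerivAt.fun_sum fun j _ => hint j)).congr_deriv ?_
  simp only [dotProduct, Pi.add_apply, add_mul, Finset.sum_add_distrib, mul_comm (d _)]

/- At a minimizer `v` of the potential over the box, moving towards `w = -G⁻¹ r(v)`, which lies in
the box, changes the potential at rate `-(w - v)ᵀ G (w - v)`; so `w = v`. -/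
theorem exists_mulVec_add_eq_zero_of_continuous [DecidableEq ι] {G : Matrix ι ι ℝ}
    (hG : G.PosDef) {r : ι → ℝ → ℝ} (hr : ∀ j, Continuous (r j)) {C : ℝ} (hC : 0 ≤ C)
    (hmaps : ∀ v : ι → ℝ, ‖v‖ ≤ C → ‖G⁻¹ *ᵥ fun j => r j (v j)‖ ≤ C) :
    ∃ v : ι → ℝ, ‖v‖ ≤ C ∧ G *ᵥ v + (fun j => r j (v j)) = 0 := by
  simp only [← mem_closedBall_zero_iff] at hmaps ⊢
  have hdet : IsUnit G.det := (isUnit_iff_isUnit_det G).1 hG.isUnit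
  obtain ⟨v, hv, hmin⟩ := (isCompact_closedBall (0 : ι → ℝ) C).exists_isMinOn
    (Metric.nonempty_closedBall.2 hC) (continuous_boxPotential G hr).continuousOn
  set g : ι → ℝ := fun j => r j (v j)
  have hw : -(G⁻¹ *ᵥ g) ∈ Metric.closedBall (0 : ι → ℝ) C := by simpa using hmaps v hv
  set w : ι → ℝ := -(G⁻¹ *ᵥ g)
  have hGw : G *ᵥ w = -g := by
    rw [mulVec_neg, mulVec_mulVec, mul_nonsing_inv _ hdet, one_mulVec]
  have hslope : 0 ≤ (w - v) ⬝ᵥ (G *ᵥ v + g) :=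
    lineDeriv_nonneg_of_isMinOn (convex_closedBall _ _) hv hw hmin
      (hasLineDerivAt_boxPotential hG.isHermitian hr v (w - v))
  have hgrad : G *ᵥ v + g = -(G *ᵥ (w - v)) := by
    rw [mulVec_sub, hGw]
    abel
  have hwv : w - v = 0 := by
    by_contra hne
    have hpos := hG.dotProduct_mulVec_pos hne
    rw [hgrad, dotProduct_neg] at hslope
    rw [star_trivial] at hpos
    linarith
  exact ⟨v, hv, by rw [hgrad, hwv, mulVec_zero, neg_zero]⟩

theorem exists_mulVec_add_eq_zero [DecidableEq ι] {G : Matrix ι ι ℝ} (hG : G.PosDef)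
    {r : ι → ℝ → ℝ} {C : ℝ} (hC : 0 ≤ C) (hr : ∀ j, ContinuousOn (r j) (Set.Icc (-C) C))
    (hmaps : ∀ v : ι → ℝ, ‖v‖ ≤ C → ‖G⁻¹ *ᵥ fun j => r j (v j)‖ ≤ C) :
    ∃ v : ι → ℝ, ‖v‖ ≤ C ∧ G *ᵥ v + (fun j => r j (v j)) = 0 := by
  have hCC : -C ≤ C := neg_le_self hC
  let r' (j : ι) : ℝ → ℝ := Set.IccExtend hCC ((Set.Icc (-C) C).domRestrict (r j))
  have hext (v : ι → ℝ) (hv : ‖v‖ ≤ C) : (fun j => r' j (v j)) = fun j => r j (v j) :=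
    funext fun j => Set.IccExtend_of_mem hCC _ (abs_le.1 ((norm_le_pi_norm v j).trans hv))
  obtain ⟨v, hv, hzero⟩ := exists_mulVec_add_eq_zero_of_continuous hG (r := r')
    (fun j => (hr j).domRestrict.Icc_extend') hC
    fun v hv => by simpa only [hext v hv] using hmaps v hv
  exact ⟨v, hv, hext v hv ▸ hzero⟩

end BoxZero

/-! ### A local solution near the oracle estimator -/

theorem posDef_inv_smul_gram (hn : 0 < n) {X : Matrix (Fin n) (Fin p) ℝ} {S : Finset (Fin p)}
    (hgram : IsUnit (gram X S).det) : ((n : ℝ)⁻¹ • gram X S).PosDef := by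
  have hpos : (gram X S).PosSemidef := by
    simpa [gram] using posSemidef_conjTranspose_mul_self (cols X S)
  exact (hpos.posDef_iff_det_ne_zero.2 hgram.ne_zero).smul (inv_pos.2 (Nat.cast_pos.2 hn))

theorem inv_smul_gram_inv (hn : 0 < n) {X : Matrix (Fin n) (Fin p) ℝ} {S : Finset (Fin p)}
    (hgram : IsUnit (gram X S).det) : ((n : ℝ)⁻¹ • gram X S)⁻¹ = (n : ℝ) • (gram X S)⁻¹ := by
  have hn' : (n : ℝ) ≠ 0 := Nat.cast_ne_zero.2 hn.ne'
  refine inv_eq_right_inv ?_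
  rw [smul_mul_smul_comm, inv_mul_cancel₀ hn', one_smul, mul_nonsing_inv _ hgram]

theorem score_mulVec_of_mem {X : Matrix (Fin n) (Fin p) ℝ} {S : Finset (Fin p)} {w : Fin p → ℝ}
    (hw : ∀ j ∉ S, w j = 0) {j : Fin p} (hj : j ∈ S) :
    score X (X *ᵥ w) j = (((n : ℝ)⁻¹ • gram X S) *ᵥ fun j => w j) ⟨j, hj⟩ := by
  rw [score_apply, mulVec_eq_cols_mulVec X hw, smul_mulVec, gram_mulVec, Pi.smul_apply,
    smul_eq_mul, div_eq_inv_mul]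
  rfl

theorem theta1_mem {X : Matrix (Fin n) (Fin p) ℝ} {S : Finset (Fin p)} {l : ℝ} (hl : 0 ≤ l)
    {r : ℝ → ℝ} {b : Fin p → ℝ} (hne : (theta1Set X S l r b).Nonempty) :
    theta1 X S l r b ∈ theta1Set X S l r b := by
  refine ⟨Real.sInf_nonneg fun _ hθ => hθ.1, fun v hv => ?_⟩
  have hle : ∀ θ ∈ theta1Set X S l r b,
      ‖((n : ℝ)⁻¹ • gram X S)⁻¹ *ᵥ fun j => r (v j + b j)‖ ≤ θ * l := fun θ hθ =>
    hθ.2 v (hv.trans (mul_le_mul_of_nonneg_right (csInf_le ⟨0, fun _ h => h.1⟩ hθ) hl))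
  rcases hl.eq_or_lt with rfl | hl
  · obtain ⟨θ, hθ⟩ := hne
    simpa only [mul_zero] using hle θ hθ
  · rw [← div_le_iff₀ hl]
    exact le_csInf hne fun θ hθ => (div_le_iff₀ hl).2 (hle θ hθ)

/- The supremum defining `θ₂` is finite because `(X_Sᵀ X_S / n)⁻¹ ρ̇(v_S + b_S)` stays in a compact
ball. -/
theorem norm_le_theta2_mul (hn : 0 < n) {X : Matrix (Fin n) (Fin p) ℝ} {S : Finset (Fin p)}
    (hgram : IsUnit (gram X S).det) {l : ℝ} (hl : 0 < l) {r : ℝ → ℝ} {b : Fin p → ℝ}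
    (hne : (theta1Set X S l r b).Nonempty) {v : {j // j ∈ S} → ℝ}
    (hv : ‖v‖ ≤ theta1 X S l r b * l) :
    ‖(cols X Sᶜ)ᵀ *ᵥ (cols X S *ᵥ ((gram X S)⁻¹ *ᵥ fun j => r (v j + b j)))‖
      ≤ theta2 X S l r b * l := by
  rw [← div_le_iff₀ hl]
  refine le_csSup ?_ ⟨v, hv, rfl⟩
  have hcont : Continuous fun x : {j // j ∈ S} → ℝ =>
      ‖(cols X Sᶜ)ᵀ *ᵥ (cols X S *ᵥ ((n : ℝ)⁻¹ • x))‖ / l := by fun_prop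
  refine ((isCompact_closedBall (0 : {j // j ∈ S} → ℝ)
    (theta1 X S l r b * l)).bddAbove_image hcont.continuousOn).mono ?_
  rintro _ ⟨v, hv, rfl⟩
  refine ⟨((n : ℝ)⁻¹ • gram X S)⁻¹ *ᵥ fun j => r (v j + b j),
    mem_closedBall_zero_iff.2 ((theta1_mem hl.le hne).2 v hv), ?_⟩
  simp only [inv_smul_gram_inv hn hgram, smul_mulVec]
  rw [inv_smul_smul₀ (Nat.cast_ne_zero.2 hn.ne')]

theorem exists_score_eq_neg (hn : 0 < n) {X : Matrix (Fin n) (Fin p) ℝ} {S : Finset (Fin p)}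
    (hgram : IsUnit (gram X S).det) {l : ℝ} (hl : 0 ≤ l) {r : ℝ → ℝ} {b : Fin p → ℝ} {θ : ℝ}
    (hθ : θ ∈ theta1Set X S l r b)
    (hr : ContinuousOn r (⋃ j ∈ S, Set.Icc (b j - θ * l) (b j + θ * l))) :
    ∃ w : Fin p → ℝ, (∀ j ∉ S, w j = 0) ∧ ‖w‖ ≤ θ * l ∧
      ∀ j ∈ S, score X (X *ᵥ w) j = -r (w j + b j) := by
  have hC : 0 ≤ θ * l := mul_nonneg hθ.1 hl
  have hr' (j : {j // j ∈ S}) : ContinuousOn (fun x => r (x + b j)) (Set.Icc (-(θ * l)) (θ * l)) :=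
    hr.comp (by fun_prop) fun x hx => Set.mem_biUnion j.2 ⟨by linarith [hx.1], by linarith [hx.2]⟩
  obtain ⟨v, hv, hzero⟩ :=
    exists_mulVec_add_eq_zero (posDef_inv_smul_gram hn hgram) hC hr' hθ.2
  let w : Fin p → ℝ := Function.extend Subtype.val v 0
  have hwv (j : {j // j ∈ S}) : w j = v j := Subtype.val_injective.extend_apply v 0 j
  have hwS : ∀ j ∉ S, w j = 0 := fun j hj =>
    Function.extend_apply' _ _ _ fun ⟨i, hi⟩ => hj (hi ▸ i.2)
  refine ⟨w, hwS, (pi_norm_le_iff_of_nonneg hC).2 fun j => ?_, fun j hj => ?_⟩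
  · by_cases hj : j ∈ S
    · exact hwv ⟨j, hj⟩ ▸ (norm_le_pi_norm v _).trans hv
    · simpa [hwS j hj] using hC
  · rw [score_mulVec_of_mem hwS hj, funext hwv, hwv ⟨j, hj⟩]
    exact eq_neg_of_add_eq_zero_left (congrFun hzero ⟨j, hj⟩)

theorem abs_score_le_theta2_mul (hn : 0 < n) {X : Matrix (Fin n) (Fin p) ℝ}
    {S : Finset (Fin p)} (hgram : IsUnit (gram X S).det) {l : ℝ} (hl : 0 ≤ l) {r : ℝ → ℝ}
    {b w : Fin p → ℝ} (hne : (theta1Set X S l r b).Nonempty) (hwS : ∀ j ∉ S, w j = 0)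
    (hw : ‖w‖ ≤ theta1 X S l r b * l) (hscore : ∀ j ∈ S, score X (X *ᵥ w) j = -r (w j + b j))
    {j : Fin p} (hj : j ∉ S) : |score X (X *ᵥ w) j| ≤ theta2 X S l r b * l := by
  rcases hl.eq_or_lt with rfl | hl
  · rw [mul_zero, norm_le_zero_iff] at hw
    simp [hw]
  have hn' : (n : ℝ) ≠ 0 := Nat.cast_ne_zero.2 hn.ne'
  let v : {j // j ∈ S} → ℝ := fun j => w j
  have hv : ‖v‖ ≤ theta1 X S l r b * l :=
    ((pi_norm_le_iff_of_nonneg (norm_nonneg w)).2 fun j : {j // j ∈ S} =>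
      norm_le_pi_norm w j).trans hw
  have hsolve : v = -((n : ℝ) • ((gram X S)⁻¹ *ᵥ fun j => r (v j + b j))) := by
    have hGv : ((n : ℝ)⁻¹ • gram X S) *ᵥ v = -fun j : {j // j ∈ S} => r (v j + b j) :=
      funext fun j => (score_mulVec_of_mem hwS j.2).symm.trans (hscore j j.2)
    rw [← smul_mulVec, ← inv_smul_gram_inv hn hgram, ← mulVec_neg, ← hGv, mulVec_mulVec,
      nonsing_inv_mul _ ((isUnit_iff_isUnit_det _).1 (posDef_inv_smul_gram hn hgram).isUnit),
      one_mulVec]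
  have hcross : score X (X *ᵥ w) j
      = -((cols X Sᶜ)ᵀ *ᵥ (cols X S *ᵥ ((gram X S)⁻¹ *ᵥ fun j => r (v j + b j))))
        ⟨j, Finset.mem_compl.2 hj⟩ := by
    rw [score_apply, mulVec_eq_cols_mulVec X hwS, div_eq_iff hn']
    change ((cols X Sᶜ)ᵀ *ᵥ (cols X S *ᵥ v)) ⟨j, Finset.mem_compl.2 hj⟩ = _
    nth_rw 1 [hsolve]
    simp only [mulVec_neg, mulVec_smul, Pi.neg_apply, Pi.smul_apply, smul_eq_mul]
    ring
  rw [hcross, abs_neg]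
  exact (norm_le_pi_norm _ _).trans (norm_le_theta2_mul hn hgram hl hne hv)

theorem sign_add_of_abs_lt {a v : ℝ} (h : |v| < |a|) : Real.sign (a + v) = Real.sign a := by
  rcases lt_trichotomy a 0 with ha | rfl | ha
  · rw [abs_of_neg ha, abs_lt] at h
    rw [Real.sign_of_neg ha, Real.sign_of_neg (by linarith)]
  · exact absurd h (by simp)
  · rw [abs_of_pos ha, abs_lt] at h
    rw [Real.sign_of_pos ha, Real.sign_of_pos (by linarith)]

theorem exists_isApproxLocal_near_oracle (hn : 0 < n) (hρ : IsPenalty ρ)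
    {X : Matrix (Fin n) (Fin p) ℝ} {β : Fin p → ℝ} {ε : Fin n → ℝ} {S : Finset (Fin p)}
    (hβ : ∀ j ∉ S, β j = 0) (hgram : IsUnit (gram X S).det) {βo : Fin p → ℝ}
    (hβo : βo = oracle X (X *ᵥ β + ε) S) {l : ℝ} (hl : l = threshold ρ) {r : ℝ → ℝ}
    (hr : ∀ t, r t ∈ pdot ρ t) {θ : ℝ} (hθ : θ = theta1 X S l r βo)
    (hne : (theta1Set X S l r βo).Nonempty)
    (hcont : ContinuousOn r (⋃ j ∈ S, Set.Icc (βo j - θ * l) (βo j + θ * l)))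
    (hmin : ∀ j ∈ S, θ * l < |βo j|)
    (hnoise : ∀ j ∉ S, |score X (projPerp X S ε) j| ≤ (1 - theta2 X S l r βo) * l) :
    ∃ b : Fin p → ℝ, IsApproxLocal X (X *ᵥ β + ε) ρ 0 b ∧
      (∀ j, Real.sign (b j) = Real.sign (βo j)) ∧ ‖b - βo‖ ≤ θ * l := by
  have hl0 : 0 ≤ l := hl ▸ hρ.threshold_nonneg
  obtain ⟨w, hwS, hw, hscore⟩ :=
    exists_score_eq_neg hn hgram hl0 (hθ ▸ theta1_mem hl0 hne) hcont
  obtain ⟨D, hD⟩ := exists_hasRightSlope_zero hρ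
  have hgrad (j : Fin p) : score X (X *ᵥ (βo + w) - (X *ᵥ β + ε)) j
      = score X (X *ᵥ w) j - score X (projPerp X S ε) j := hβo ▸ score_oracle_add ε hβ hgram w j
  refine ⟨βo + w, ⟨fun j => -score X (X *ᵥ (βo + w) - (X *ᵥ β + ε)) j, fun j => ?_, ?_⟩,
    fun j => ?_, by rwa [add_sub_cancel_left]⟩
  · beta_reduce
    rw [hgrad]
    by_cases hj : j ∈ S
    · rw [score_projPerp X ε hj, hscore j hj, sub_zero, neg_neg, Pi.add_apply, add_comm]
      exact hr _
    · have hzero : (βo + w) j = 0 := by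
        rw [Pi.add_apply, hwS j hj, hβo, oracle_of_notMem X _ hj, add_zero]
      have hoff := abs_score_le_theta2_mul hn hgram hl0 hne hwS (hθ ▸ hw) hscore hj
      rw [hzero]
      refine mem_pdot_zero hρ hD (le_trans (EReal.coe_le_coe_iff.2 ?_)
        (hl ▸ threshold_le_rightSlope hρ hD))
      rw [abs_neg]
      linarith [abs_sub (score X (X *ᵥ w) j) (score X (projPerp X S ε) j), hnoise j hj]
  · simp [score_apply]
  · by_cases hj : j ∈ S
    · exact sign_add_of_abs_lt (((norm_le_pi_norm w j).trans hw).trans_lt (hmin j hj))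
    · rw [Pi.add_apply, hwS j hj, add_zero]

end

end PenLS

theorem theorem6_general {n p : ℕ} (hn : 0 < n)
    (X : Matrix (Fin n) (Fin p) ℝ) (hX : ∀ j, ∑ i, X i j ^ 2 = n)
    (β : Fin p → ℝ) (ε y : Fin n → ℝ) (hy : y = X.mulVec β + ε)
    (ρ : ℝ → ℝ) (lam : ℝ) (hlam : 0 < lam)
    (hρ : PenLS.IsPenalty ρ) (hdiff : PenLS.LRDifferentiable ρ)
    (S : Finset (Fin p)) (hS : PenLS.supp β ⊆ S)
    (hgram : IsUnit (PenLS.gram X S).det)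
    (βo : Fin p → ℝ) (hβo : βo = PenLS.oracle X y S)
    (lamStar : ℝ) (hlamStar : lamStar = PenLS.threshold ρ) :
    (∀ D : EReal, PenLS.HasRightSlope ρ 0 D →
      ((‖fun j : {j // j ∈ Sᶜ} =>
          (X.transpose.mulVec (PenLS.projPerp X S ε)) j / n‖ : ℝ) : EReal) ≤ D →
      (∀ d : Fin p → ℝ, (∀ j ∈ S, d j ∈ PenLS.pdot ρ (βo j)) →
        PenLS.IsApproxLocal X y ρ (∑ j ∈ S, d j ^ 2) βo) ∧
      (∀ (η m κ : ℝ) (d : Fin p → ℝ), 0 < η → η < 1 → PenLS.NullConsistent X ε ρ η →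
        (PenLS.IsSparsityBound X ε ρ S η m ∨ PenLS.IsSparsityBoundBounded X ρ lam S η m) →
        0 ≤ κ → ENNReal.ofReal κ < PenLS.kappaMinus X (m + S.card) →
        PenLS.IsApproxLocalWith X y ρ (∑ j ∈ S, d j ^ 2) βo d →
        ∑ j ∈ S, d j ^ 2 = 0 →
        (∀ j, PenLS.nonconvexity ρ κ (βo j) (d j) = 0) →
        PenLS.IsGlobalSolution X y ρ βo)) ∧
    (∀ r : ℝ → ℝ, (∀ t, r t ∈ PenLS.pdot ρ t) →
      ∀ θ₁ θ₂ : ℝ, (PenLS.theta1Set X S lamStar r βo).Nonempty →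
      θ₁ = PenLS.theta1 X S lamStar r βo → θ₂ = PenLS.theta2 X S lamStar r βo →
      ContinuousOn r
        (⋃ j ∈ S, Set.Icc (βo j - θ₁ * lamStar) (βo j + θ₁ * lamStar)) →
      (∀ j ∈ S, θ₁ * lamStar < |βo j|) →
      θ₂ < 1 →
      ‖fun j : Fin p => (X.transpose.mulVec (PenLS.projPerp X S ε)) j / n‖ / (1 - θ₂)
        ≤ lamStar →
      (∃ b : Fin p → ℝ, PenLS.IsApproxLocal X y ρ 0 b ∧
        (∀ j, Real.sign (b j) = Real.sign (βo j)) ∧ ‖b - βo‖ ≤ θ₁ * lamStar) ∧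
      (∀ b d : Fin p → ℝ, PenLS.IsApproxLocalWith X y ρ 0 b d →
        (∀ j, Real.sign (b j) = Real.sign (βo j)) →
        ∀ η m κ : ℝ, 0 < η → η < 1 → PenLS.NullConsistent X ε ρ η →
        (PenLS.IsSparsityBound X ε ρ S η m ∨ PenLS.IsSparsityBoundBounded X ρ lam S η m) →
        0 ≤ κ → ENNReal.ofReal κ < PenLS.kappaMinus X (m + S.card) →
        (∀ j, PenLS.nonconvexity ρ κ (b j) (d j) = 0) →
        PenLS.IsGlobalSolution X y ρ b)) := by
  subst hy
  have hβ : ∀ j ∉ S, β j = 0 := fun j hj => by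
    by_contra hne
    exact hj (hS (by simpa [PenLS.supp] using hne))
  have hβoS : ∀ j ∉ S, βo j = 0 := fun j hj => hβo ▸ PenLS.oracle_of_notMem X _ hj
  refine ⟨fun D hD hnoise => ⟨fun d hd => ?_, fun η m κ d hη hη1 hnull hm hκ hκm hb hd0 hθ => ?_⟩,
    fun r hr θ₁ θ₂ hne hθ₁ hθ₂ hcont hmin hθ₂1 hnoise => ⟨?_,
      fun b d hb hsign η m κ hη hη1 hnull hm hκ hκm hθ => ?_⟩⟩
  · subst hβo
    refine PenLS.isApproxLocal_oracle hρ hD hβ hgram (fun j hj => ?_) hd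
    rw [PenLS.score_apply]
    exact (EReal.coe_le_coe_iff.2 (norm_le_pi_norm (fun j : {j // j ∈ Sᶜ} =>
      (X.transpose.mulVec (PenLS.projPerp X S ε)) j / n)
      ⟨j, Finset.mem_compl.2 hj⟩)).trans hnoise
  · exact PenLS.isGlobalSolution_of_isApproxLocalWith hn hρ hdiff hX hβ hlam hη hη1 hnull hm hκ
      hκm (hd0 ▸ hb) hβoS hθ
  · refine PenLS.exists_isApproxLocal_near_oracle hn hρ hβ hgram hβo hlamStar hr hθ₁ hne hcont
      hmin fun j _ => ?_
    rw [← hθ₂, mul_comm, ← div_le_iff₀ (sub_pos.2 hθ₂1), PenLS.score_apply]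
    exact (div_le_div_of_nonneg_right (norm_le_pi_norm (fun j =>
      (X.transpose.mulVec (PenLS.projPerp X S ε)) j / (n : ℝ)) j)
      (sub_nonneg.2 hθ₂1.le)).trans hnoise
  · exact PenLS.isGlobalSolution_of_isApproxLocalWith hn hρ hdiff hX hβ hlam hη hη1 hnull hm hκ
      hκm hb (fun j hj => Real.sign_eq_zero_iff.1 (by rw [hsign, hβoS j hj, Real.sign_zero])) hθ

theorem theorem6 {n p : ℕ} (hn : 0 < n)
    (X : Matrix (Fin n) (Fin p) ℝ) (hX : ∀ j, ∑ i, X i j ^ 2 = n)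
    (β : Fin p → ℝ) (ε y : Fin n → ℝ) (hy : y = X.mulVec β + ε)
    (ρ : ℝ → ℝ) (lam : ℝ) (hlam : 0 < lam)
    (hρ : PenLS.IsPenalty ρ) (hdiff : PenLS.LRDifferentiable ρ)
    (S : Finset (Fin p)) (hS : S = PenLS.supp β)
    (hgram : IsUnit (PenLS.gram X S).det)
    (βo : Fin p → ℝ) (hβo : βo = PenLS.oracle X y S)
    (lamStar : ℝ) (hlamStar : lamStar = PenLS.threshold ρ) :
    -- part (i)
    (∀ D : EReal, PenLS.HasRightSlope ρ 0 D →
      ((‖fun j : {j // j ∈ Sᶜ} =>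
          (X.transpose.mulVec (PenLS.projPerp X S ε)) j / n‖ : ℝ) : EReal) ≤ D →
      (∀ d : Fin p → ℝ, (∀ j ∈ S, d j ∈ PenLS.pdot ρ (βo j)) →
        PenLS.IsApproxLocal X y ρ (∑ j ∈ S, d j ^ 2) βo) ∧
      (∀ (η m κ : ℝ) (d : Fin p → ℝ), 0 < η → η < 1 → PenLS.NullConsistent X ε ρ η →
        (PenLS.IsSparsityBound X ε ρ S η m ∨ PenLS.IsSparsityBoundBounded X ρ lam S η m) →
        0 ≤ κ → ENNReal.ofReal κ < PenLS.kappaMinus X (m + S.card) →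
        PenLS.IsApproxLocalWith X y ρ (∑ j ∈ S, d j ^ 2) βo d →
        ∑ j ∈ S, d j ^ 2 = 0 →
        (∀ j, PenLS.nonconvexity ρ κ (βo j) (d j) = 0) →
        PenLS.IsGlobalSolution X y ρ βo)) ∧
    -- part (ii)
    (∀ r : ℝ → ℝ, (∀ t, r t ∈ PenLS.pdot ρ t) →
      ∀ θ₁ θ₂ : ℝ, (PenLS.theta1Set X S lamStar r βo).Nonempty →
      θ₁ = PenLS.theta1 X S lamStar r βo → θ₂ = PenLS.theta2 X S lamStar r βo →
      UniformContinuousOn r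
        (⋃ j ∈ S, Set.Icc (βo j - θ₁ * lamStar) (βo j + θ₁ * lamStar)) →
      (∀ j, Real.sign (βo j) = Real.sign (β j)) →
      (∀ j ∈ S, θ₁ * lamStar < |βo j|) →
      θ₂ < 1 →
      ‖fun j : Fin p => (X.transpose.mulVec (PenLS.projPerp X S ε)) j / n‖ / (1 - θ₂)
        ≤ lamStar →
      (∃ b : Fin p → ℝ, PenLS.IsApproxLocal X y ρ 0 b ∧
        (∀ j, Real.sign (b j) = Real.sign (β j)) ∧ ‖b - βo‖ ≤ θ₁ * lamStar) ∧
      (∀ b d : Fin p → ℝ, PenLS.IsApproxLocalWith X y ρ 0 b d →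
        (∀ j, Real.sign (b j) = Real.sign (β j)) → ‖b - βo‖ ≤ θ₁ * lamStar →
        ∀ η m κ : ℝ, 0 < η → η < 1 → PenLS.NullConsistent X ε ρ η →
        (PenLS.IsSparsityBound X ε ρ S η m ∨ PenLS.IsSparsityBoundBounded X ρ lam S η m) →
        0 ≤ κ → ENNReal.ofReal κ < PenLS.kappaMinus X (m + S.card) →
        (∀ j, PenLS.nonconvexity ρ κ (b j) (d j) = 0) →
        PenLS.IsGlobalSolution X y ρ b)) := by
  obtain ⟨horacle, hnear⟩ := theorem6_general hn X hX β ε y hy ρ lam hlam hρ hdiff S hS.ge hgram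
    βo hβo lamStar hlamStar
  refine ⟨horacle, fun r hr θ₁ θ₂ hne hθ₁ hθ₂ hunif hsign hmin hθ₂1 hnoise => ?_⟩
  simp only [← hsign]
  exact (hnear r hr θ₁ θ₂ hne hθ₁ hθ₂ hunif.continuousOn hmin hθ₂1 hnoise).imp_right
    fun hglobal b d hb hbsign _ => hglobal b d hb hbsign
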